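/- Let $N\ge 1$, $J>0$ and $\beta>0$, and let $\sigma^x_j,\sigma^y_j,\sigma^z_j$ be the Pauli matrices acting on the $j$-th of $N$ qubits, with $\sigma^z_{N+1}=\sigma^z_1$. Consider on $\mathbb{C}^{2^N}$ the periodic ferromagnetic Ising Hamiltonian $$H=-J\sum_{j=1}^N\sigma^z_j\sigma^z_{j+1},$$ with Gibbs state $\sigma_\beta=e^{-\beta H}/\operatorname{Tr}(e^{-\beta H})$. For a self-adjoint operator $S$ and $\omega\in B_H=\{\lambda-\mu:\lambda,\mu\in\operatorname{Spec}(H)\}$ put $S(\omega)=\sum_{\lambda-\mu=\omega}P_\lambda S P_\mu$, where $P_\lambda$ is the orthogonal projection onto the eigenspace of $H$ for $\lambda$, and $$\mathcal{L}_S(A)=\sum_{\omega\in B_H}\gamma(\omega)\Big(S(\omega)^\dagger A\,S(\omega)-\tfrac12\{S(\omega)^\dagger S(\omega),A\}\Big),\qquad \gamma(\omega)=\frac{2}{e^{\beta\omega}+1}.$$ Consider the Davies generator with all local Pauli couplings and the global coupling $\mathsf{X}=\prod_{j=1}^N\sigma^x_j$, $$\mathcal{L}_\beta=\sum_{j=1}^N\big(\mathcal{L}_{\sigma^x_j}+\mathcal{L}_{\sigma^y_j}+\mathcal{L}_{\sigma^z_j}\big)+\mathcal{L}_{\mathsf{X}}.$$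 Then $\mathcal{L}_\beta$ is primitive, that is, $\ker\mathcal{L}_\beta=\mathbb{C}\mathbf{1}$, and its spectral gap $$\operatorname{Gap}(\mathcal{L}_\beta)=\inf_{A\neq0,\ \operatorname{Tr}(\sigma_\beta A)=0}\frac{\langle A,-\mathcal{L}_\beta(A)\rangle_{\sigma_\beta}}{\langle A,A\rangle_{\sigma_\beta}},\qquad \langle B,A\rangle_{\sigma_\beta}=\operatorname{Tr}(B^\dagger A\,\sigma_\beta),$$ satisfies $$\operatorname{Gap}(\mathcal{L}_\beta)\ \ge\ \max\big\{c_1e^{-4\beta J},\ c_2N^{-2}\big\}$$ with universal constants $c_1,c_2>0$ that do not depend on $N$, $J$ or $\beta$. -/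

import Mathlib

open scoped Matrix

noncomputable section

namespace DaviesIsing

section Davies

variable {n : Type*} [Fintype n] [DecidableEq n]

/-- The set `Spec(H)` of real eigenvalues of a matrix `H` (all its eigenvalues if `H` is
Hermitian), as a finset. -/
def spec (H : Matrix n n ℂ) : Finset ℝ :=
  (Matrix.finite_real_spectrum (A := H)).toFinset

/-- The matrix of the orthogonal projection of `ℂⁿ` onto the eigenspace of `H` for `l`
(it is `0` if `l` is not an eigenvalue). -/
def eigenProj (H : Matrix n n ℂ) (l : ℝ) : Matrix n n ℂ :=
  Matrix.toEuclideanLin.symm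
    ((Module.End.eigenspace (Matrix.toEuclideanLin H) (l : ℂ)).starProjection :
      EuclideanSpace ℂ n →ₗ[ℂ] EuclideanSpace ℂ n)

/-- The Bohr frequencies `B_H = {l - m : l, m ∈ Spec(H)}`. -/
def bohrFreq (H : Matrix n n ℂ) : Finset ℝ :=
  Finset.image (fun p : ℝ × ℝ => p.1 - p.2) (spec H ×ˢ spec H)

/-- The jump operator `S(ω) = ∑_{l - m = ω} P_l S P_m`, the component of frequency `ω` of
`t ↦ exp(iHt) S exp(-iHt)`. -/
def jump (H S : Matrix n n ℂ) (ω : ℝ) : Matrix n n ℂ :=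
  ∑ p ∈ (spec H ×ˢ spec H).filter (fun p : ℝ × ℝ => p.1 - p.2 = ω),
    eigenProj H p.1 * S * eigenProj H p.2

/-- The Glauber transition rate `γ(ω) = 2 / (exp(βω) + 1)`. -/
def glauberRate (β ω : ℝ) : ℝ := 2 / (Real.exp (β * ω) + 1)

/-- The Davies generator of the Hamiltonian `H` with the single coupling operator `S` at inverse
temperature `β`, in the Heisenberg picture:
`𝓛_S(X) = ∑_ω γ(ω) (S(ω)† X S(ω) - ½ {S(ω)† S(ω), X})`. -/
def davies (H : Matrix n n ℂ) (β : ℝ) (S X : Matrix n n ℂ) : Matrix n n ℂ :=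
  ∑ ω ∈ bohrFreq H, (glauberRate β ω : ℂ) •
    ((jump H S ω)ᴴ * X * jump H S ω
      - (1 / 2 : ℂ) • ((jump H S ω)ᴴ * jump H S ω * X + X * ((jump H S ω)ᴴ * jump H S ω)))

/-- The Gibbs state `exp(-βH) / Tr exp(-βH)`. -/
def gibbs (H : Matrix n n ℂ) (β : ℝ) : Matrix n n ℂ :=
  (NormedSpace.exp ((-β : ℂ) • H)).trace⁻¹ • NormedSpace.exp ((-β : ℂ) • H)

/-- The GNS inner product `⟨Y, X⟩_σ = Tr(Y† X σ)`. -/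
def gnsInner (σ Y X : Matrix n n ℂ) : ℂ := (Yᴴ * X * σ).trace

/-- A generator `L` on observables is primitive if its kernel is the span of the identity. -/
def IsPrimitive (L : Matrix n n ℂ → Matrix n n ℂ) : Prop :=
  ∀ X, L X = 0 ↔ ∃ c : ℂ, X = c • (1 : Matrix n n ℂ)

/-- The spectral gap of a primitive generator `L` in detailed balance with `σ`:
the infimum of `⟨X, -L X⟩_σ / ⟨X, X⟩_σ` over `X ≠ 0` with `Tr(σ X) = 0`. -/
def spectralGap (σ : Matrix n n ℂ) (L : Matrix n n ℂ → Matrix n n ℂ) : ℝ :=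
  sInf {r : ℝ | ∃ X : Matrix n n ℂ, X ≠ 0 ∧ (σ * X).trace = 0 ∧
    r = (gnsInner σ X (-L X)).re / (gnsInner σ X X).re}

end Davies

section Ising

/-- The Pauli matrix `σˣ`. -/
def pauliX : Matrix (Fin 2) (Fin 2) ℂ := !![0, 1; 1, 0]

/-- The Pauli matrix `σʸ`. -/
def pauliY : Matrix (Fin 2) (Fin 2) ℂ := !![0, -Complex.I; Complex.I, 0]

/-- The Pauli matrix `σᶻ`. -/
def pauliZ : Matrix (Fin 2) (Fin 2) ℂ := !![1, 0; 0, -1]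

/-- Operators on the space of `N` qubits, as matrices in the computational basis. -/
abbrev QubitOp (N : ℕ) := Matrix (Fin N → Fin 2) (Fin N → Fin 2) ℂ

/-- The operator that acts as the matrix `A` on qubit `j` and as the identity on all others. -/
def onSite {N : ℕ} (j : Fin N) (A : Matrix (Fin 2) (Fin 2) ℂ) : QubitOp N :=
  Matrix.of fun s t => if ∀ i, i ≠ j → s i = t i then A (s j) (t j) else 0

/-- The ferromagnetic Ising Hamiltonian `-J ∑_j σᶻ_j σᶻ_{j+1}` on a ring of `N` spins
(addition in `Fin N` is modulo `N`). -/
def isingHamiltonian (N : ℕ) [NeZero N] (J : ℝ) : QubitOp N :=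
  (-J : ℂ) • ∑ j : Fin N, onSite j pauliZ * onSite (j + 1) pauliZ

/-- The global coupling operator `∏_j σˣ_j`. -/
def globalX (N : ℕ) : QubitOp N :=
  (List.ofFn fun j : Fin N => onSite j pauliX).prod

/-- The Davies generator of the Ising ring with all local Pauli couplings and the global
coupling `∏_j σˣ_j`. -/
def isingDavies (N : ℕ) [NeZero N] (J β : ℝ) (X : QubitOp N) : QubitOp N :=
  ∑ j : Fin N,
      (davies (isingHamiltonian N J) β (onSite j pauliX) X
        + davies (isingHamiltonian N J) β (onSite j pauliY) X
        + davies (isingHamiltonian N J) β (onSite j pauliZ) X)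
    + davies (isingHamiltonian N J) β (globalX N) X

end Ising

end DaviesIsing

end

/-!
The Ising Hamiltonian is diagonal in the computational basis, and each coupling is a monomial
matrix: a phase times the flip of some set of spins. Hence the Davies generator acts on the entries
of an observable (`davies_diagonal_apply`) and does not mix the diagonal with the off-diagonal ones.

*Off-diagonal entries.* By detailed balance every coupling contributes a nonnegative amount to the
Dirichlet form (`sum_offDiag_davies_nonneg`), and `σᶻ_j` makes an entry at `(t, s)` with `t j ≠ s j`
decay at rate `2`. So the gap on these entries is at least `2` (`two_mul_sum_offDiag_le`).

*Diagonal entries.* Here the generator is that of Glauber dynamics on the ring at twice the usual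
speed, with parameter `t = tanh (2βJ)` (`t = 0` if `N = 1`), together with a simultaneous flip of all spins at rate `1`
(`isingDavies_apply_self`). Glauber dynamics in one dimension is dual to annihilating random walks:
the generator applied to a product of spins `∏_{i ∈ A} sᵢ` moves the points of `A` to neighbouring
sites, two points that meet disappear, and each point is killed at rate `4 (1 - t)`
(`ringGlauber_spinProd`). Therefore the correlations of a centred eigenfunction with the products of
spins, restricted to the smallest size `k ≥ 1` of `A` on which they do not all vanish, are an
eigenvector of `k` walks that are killed when they meet (`ringGlauber_eigenvalue_bound`).
A maximum principle bounds the eigenvalue (`eigenvalue_le_of_drift`):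
for `k = 1` the global flip, which changes the sign of the correlation, gives `2`; for `k ≥ 2`
comparison with the function `A ↦ ∑_{i ≠ a ∈ A} |sin (π (i - a) / N)|` gives
`8 (1 - t cos (π / N))`, which is at least both `8 (1 - t)` and `16 / N²`.

Since the generator is symmetric, the bounds on the eigenvalues yield a Poincaré inequality
(`poincare_of_forall_eigenfunction`, `ising_poincare`), which gives primitivity as well as the gap.
-/

noncomputable section

namespace DaviesIsing

/-! ### Davies generators with a diagonal Hamiltonian -/

section Diagonal

variable {n : Type*} [Fintype n] [DecidableEq n]

theorem mem_spec_diagonal (E : n → ℝ) (l : ℝ) :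
    l ∈ spec (Matrix.diagonal fun s => (E s : ℂ)) ↔ ∃ s, E s = l := by
  have h : algebraMap ℝ (Matrix n n ℂ) l - Matrix.diagonal (fun s => (E s : ℂ))
      = Matrix.diagonal fun s => ((l : ℂ) - E s) := by
    rw [Matrix.algebraMap_eq_diagonal, Matrix.diagonal_sub]
    rfl
  simp only [spec, Set.Finite.mem_toFinset, spectrum.mem_iff, h, Matrix.isUnit_diagonal,
    Pi.isUnit_iff, isUnit_iff_ne_zero, not_forall, not_not, sub_eq_zero]
  norm_cast
  simp only [eq_comm]

theorem eigenProj_diagonal (E : n → ℝ) (l : ℝ) :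
    eigenProj (Matrix.diagonal fun s => (E s : ℂ)) l
      = Matrix.diagonal fun s => if E s = l then (1 : ℂ) else 0 := by
  rw [eigenProj, LinearEquiv.symm_apply_eq]
  refine LinearMap.ext fun v => ?_
  refine Submodule.eq_starProjection_of_mem_of_inner_eq_zero ?_ fun w hw => ?_
  · rw [Module.End.mem_eigenspace_iff]
    ext s
    simp only [Matrix.toLpLin_apply, Matrix.mulVec_diagonal, PiLp.smul_apply, smul_eq_mul]
    split_ifs with h <;> simp [h]
  · rw [Module.End.mem_eigenspace_iff] at hw
    rw [PiLp.inner_apply]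
    refine Finset.sum_eq_zero fun s _ => ?_
    have hs := congrArg (fun x : EuclideanSpace ℂ n => x s) hw
    simp only [Matrix.toLpLin_apply, Matrix.mulVec_diagonal, PiLp.smul_apply, smul_eq_mul] at hs
    by_cases h : E s = l
    · simp [Matrix.toLpLin_apply, Matrix.mulVec_diagonal, h]
    · have h0 : w s = 0 := by
        by_contra hne
        exact h (Complex.ofReal_injective (mul_right_cancel₀ hne hs))
      simp [h0]

theorem jump_diagonal_apply (E : n → ℝ) (S : Matrix n n ℂ) (ω : ℝ) (t s : n) :
    jump (Matrix.diagonal fun s => (E s : ℂ)) S ω t s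
      = if E t - E s = ω then S t s else 0 := by
  simp only [jump, eigenProj_diagonal, Matrix.sum_apply, Matrix.mul_diagonal,
    Matrix.diagonal_mul]
  have key : ∀ p : ℝ × ℝ, (if E t = p.1 then (1 : ℂ) else 0) * S t s *
      (if E s = p.2 then (1 : ℂ) else 0) = if p = (E t, E s) then S t s else 0 := by
    rintro ⟨a, b⟩
    simp only [Prod.mk.injEq, eq_comm (a := a), eq_comm (a := b)]
    by_cases h1 : E t = a <;> by_cases h2 : E s = b <;> simp [h1, h2]
  simp only [key, Finset.sum_ite_eq', Finset.mem_filter, Finset.mem_product, mem_spec_diagonal,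
    exists_apply_eq_apply, true_and]

theorem sub_mem_bohrFreq_diagonal (E : n → ℝ) (t s : n) :
    E t - E s ∈ bohrFreq (Matrix.diagonal fun s => (E s : ℂ)) := by
  simp only [bohrFreq, Finset.mem_image, Finset.mem_product, mem_spec_diagonal, Prod.exists]
  exact ⟨E t, E s, ⟨⟨t, rfl⟩, s, rfl⟩, rfl⟩

/-- A Davies generator with a diagonal Hamiltonian and a monomial coupling, whose only nonzero
entries `c s` stand at the places `(p s, s)` for an involution `p`, acts entrywise: it mixes the
entries at `(t, s)` and `(p t, p s)` only. -/
theorem davies_diagonal_apply (E : n → ℝ) (β : ℝ) (p : n → n) (hp : Function.Involutive p)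
    (c : n → ℂ) (hc : ∀ s, star (c s) * c s = 1) (X : Matrix n n ℂ) (t s : n) :
    davies (Matrix.diagonal fun s => (E s : ℂ)) β
        (Matrix.of fun t s => if t = p s then c s else 0) X t s
      = (if E (p t) - E t = E (p s) - E s then (glauberRate β (E (p s) - E s) : ℂ) else 0)
            * (star (c t) * c s) * X (p t) (p s)
        - (1 / 2 : ℂ) * (glauberRate β (E (p t) - E t) + glauberRate β (E (p s) - E s))
            * X t s := by
  set H : Matrix n n ℂ := Matrix.diagonal fun s => (E s : ℂ) with hH
  set S : Matrix n n ℂ := Matrix.of fun t s => if t = p s then c s else 0 with hS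
  have hj : ∀ ω u s, jump H S ω u s
      = if u = p s then (if E (p s) - E s = ω then c s else 0) else 0 := by
    intro ω u s
    rw [hH, jump_diagonal_apply, hS, Matrix.of_apply]
    by_cases h : u = p s
    · simp [h]
    · simp [h]
  have h1 : ∀ ω (Y : Matrix n n ℂ) t s, ((jump H S ω)ᴴ * Y) t s
      = (if E (p t) - E t = ω then star (c t) else 0) * Y (p t) s := by
    intro ω Y t s
    simp only [Matrix.mul_apply, Matrix.conjTranspose_apply, hj, apply_ite star, star_zero,
      ite_mul, zero_mul, Finset.sum_ite_eq', Finset.mem_univ, if_true]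
  have h2 : ∀ ω (Y : Matrix n n ℂ) t s, (Y * jump H S ω) t s
      = Y t (p s) * (if E (p s) - E s = ω then c s else 0) := by
    intro ω Y t s
    simp only [Matrix.mul_apply, hj, mul_ite, mul_zero, Finset.sum_ite_eq', Finset.mem_univ,
      if_true]
  have h3 : ∀ ω, (jump H S ω)ᴴ * jump H S ω
      = Matrix.diagonal fun s => if E (p s) - E s = ω then (1 : ℂ) else 0 := by
    intro ω
    ext t s
    rw [h1, hj, Matrix.diagonal_apply]
    by_cases hts : t = s
    · subst hts
      by_cases hw : E (p t) - E t = ω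
      · simpa [hw] using hc t
      · simp [hw]
    · simp [hts, hp.injective.eq_iff]
  have hsum : ∀ (u : n) (z : ℂ), ∑ ω ∈ bohrFreq H,
      (glauberRate β ω : ℂ) * ((if E (p u) - E u = ω then (1 : ℂ) else 0) * z)
      = glauberRate β (E (p u) - E u) * z := by
    intro u z
    simp only [ite_mul, one_mul, zero_mul, mul_ite, mul_zero, Finset.sum_ite_eq]
    rw [if_pos (sub_mem_bohrFreq_diagonal E (p u) u)]
  have hterm : ∀ ω, ((glauberRate β ω : ℂ) •
      ((jump H S ω)ᴴ * X * jump H S ω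
        - (1 / 2 : ℂ) • ((jump H S ω)ᴴ * jump H S ω * X
          + X * ((jump H S ω)ᴴ * jump H S ω)))) t s
      = (glauberRate β ω : ℂ) * ((if E (p s) - E s = ω then (1 : ℂ) else 0) *
            ((if E (p t) - E t = E (p s) - E s then (1 : ℂ) else 0)
              * (star (c t) * c s) * X (p t) (p s)))
        - (glauberRate β ω : ℂ) * ((if E (p t) - E t = ω then (1 : ℂ) else 0)
            * ((1 / 2 : ℂ) * X t s))
        - (glauberRate β ω : ℂ) * ((if E (p s) - E s = ω then (1 : ℂ) else 0)
            * ((1 / 2 : ℂ) * X t s)) := by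
    intro ω
    rw [Matrix.smul_apply, Matrix.sub_apply, Matrix.smul_apply, Matrix.add_apply, h2, h1, h3,
      Matrix.diagonal_mul, Matrix.mul_diagonal]
    simp only [smul_eq_mul]
    by_cases hs : E (p s) - E s = ω
    · by_cases ht : E (p t) - E t = ω
      · simp only [hs, ht, if_true]; ring
      · simp only [hs, ht, if_true, if_false]; ring
    · simp only [hs, if_false]; ring
  rw [davies, Matrix.sum_apply, Finset.sum_congr rfl fun ω _ => hterm ω,
    Finset.sum_sub_distrib, Finset.sum_sub_distrib, hsum, hsum, hsum]
  split_ifs <;> ring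

theorem gibbs_diagonal (E : n → ℝ) (β : ℝ) :
    gibbs (Matrix.diagonal fun s => (E s : ℂ)) β
      = Matrix.diagonal fun s =>
          ((Real.exp (-β * E s) / ∑ u, Real.exp (-β * E u) : ℝ) : ℂ) := by
  have h : NormedSpace.exp ((-β : ℂ) • Matrix.diagonal fun s => (E s : ℂ))
      = Matrix.diagonal fun s => ((Real.exp (-β * E s) : ℝ) : ℂ) := by
    rw [← Matrix.diagonal_smul, Matrix.exp_diagonal]
    congr 1
    funext s
    rw [Pi.coe_exp, ← Complex.exp_eq_exp_ℂ]
    push_cast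
    rfl
  rw [gibbs, h, Matrix.trace_diagonal, ← Matrix.diagonal_smul]
  congr 1
  funext s
  simp only [Pi.smul_apply, smul_eq_mul]
  push_cast
  ring

theorem davies_one (H : Matrix n n ℂ) (β : ℝ) (S : Matrix n n ℂ) : davies H β S 1 = 0 := by
  refine Finset.sum_eq_zero fun ω _ => ?_
  rw [mul_one, mul_one, one_mul, ← two_smul ℂ, smul_smul]
  norm_num

theorem davies_add (H : Matrix n n ℂ) (β : ℝ) (S X Y : Matrix n n ℂ) :
    davies H β S (X + Y) = davies H β S X + davies H β S Y := by
  simp only [davies, ← Finset.sum_add_distrib]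
  refine Finset.sum_congr rfl fun ω _ => ?_
  rw [← smul_add]
  congr 1
  simp only [mul_add, add_mul, smul_add]
  abel

theorem davies_smul (H : Matrix n n ℂ) (β : ℝ) (S : Matrix n n ℂ) (a : ℂ) (X : Matrix n n ℂ) :
    davies H β S (a • X) = a • davies H β S X := by
  simp only [davies, Finset.smul_sum]
  refine Finset.sum_congr rfl fun ω _ => ?_
  simp only [Matrix.mul_smul, Matrix.smul_mul, ← smul_add, smul_sub]
  simp only [smul_smul]
  congr 2 <;> ring_nf

end Diagonal

/-! ### Poincaré inequalities from eigenvalue bounds -/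

section Poincare

open scoped InnerProductSpace

/-- A symmetric operator `T` that kills `e` is bounded below by `g` on the orthogonal complement
of `e` as soon as all its eigenvalues with an eigenvector orthogonal to `e` are at least `g`. -/
theorem mul_norm_sq_le_re_inner_of_forall_eigenvector {V : Type*} [NormedAddCommGroup V]
    [InnerProductSpace ℂ V] [FiniteDimensional ℂ V] (T : V →ₗ[ℂ] V) (hT : T.IsSymmetric)
    (e : V) (he : T e = 0) (g : ℝ)
    (hg : ∀ (μ : ℝ) (v : V), v ≠ 0 → ⟪e, v⟫_ℂ = 0 → T v = (μ : ℂ) • v → g ≤ μ)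
    (x : V) (hx : ⟪e, x⟫_ℂ = 0) : g * ‖x‖ ^ 2 ≤ (⟪x, T x⟫_ℂ).re := by
  set K : Submodule ℂ V := (ℂ ∙ e)ᗮ with hK
  have hmem : ∀ v, v ∈ K ↔ ⟪e, v⟫_ℂ = 0 := fun v => Submodule.mem_orthogonal_singleton_iff_inner_right
  have hinv : ∀ v ∈ K, T v ∈ K := fun v _ => by rw [hmem, ← hT, he, inner_zero_left]
  have hS := hT.restrict_invariant hinv
  set b := hS.eigenvectorBasis rfl with hb
  have hμ : ∀ i, g ≤ hS.eigenvalues rfl i := fun i => by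
    refine hg _ (b i : V) ?_ ((hmem _).1 (b i).2) ?_
    · simpa using (b.toBasis.ne_zero i)
    · exact congrArg Subtype.val (hS.apply_eigenvectorBasis rfl i)
  set y : K := ⟨x, (hmem x).2 hx⟩ with hy
  have h1 : ‖x‖ ^ 2 = ∑ i, ‖⟪b i, y⟫_ℂ‖ ^ 2 := (b.sum_sq_norm_inner_right y).symm
  have h2 : ⟪x, T x⟫_ℂ = ∑ i, ⟪y, b i⟫_ℂ * ⟪b i, T.restrict hinv y⟫_ℂ :=
    (b.sum_inner_mul_inner y (T.restrict hinv y)).symm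
  have h3 : ∀ i, (⟪y, b i⟫_ℂ * ⟪b i, T.restrict hinv y⟫_ℂ).re
      = hS.eigenvalues rfl i * ‖⟪b i, y⟫_ℂ‖ ^ 2 := fun i => by
    rw [← hS (b i) y, hb, hS.apply_eigenvectorBasis rfl i, ← hb, inner_smul_left,
      ← inner_conj_symm y (b i), mul_left_comm, ← Complex.normSq_eq_conj_mul_self,
      Complex.normSq_eq_norm_sq, RCLike.conj_ofReal]
    exact (Complex.re_ofReal_mul _ _).trans (by rw [Complex.ofReal_re]; rfl)
  rw [h2, Complex.re_sum, h1, Finset.mul_sum]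
  exact Finset.sum_le_sum fun i _ => by
    rw [h3]
    exact mul_le_mul_of_nonneg_right (hμ i) (by positivity)

/-- The spectral gap inequality in a weighted `ℓ²` space: an operator `L` that is symmetric for
the weights `w` and kills constants satisfies a Poincaré inequality with constant `g` as soon as
`g` bounds from below each `l` such that `-l` is an eigenvalue of `L` with a centred
eigenfunction. -/
theorem poincare_of_forall_eigenfunction {ι : Type*} [Fintype ι] (w : ι → ℝ) (hw : ∀ i, 0 < w i)
    (L : (ι → ℂ) →ₗ[ℂ] (ι → ℂ)) (hL1 : L (fun _ => 1) = 0)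
    (hsymm : ∀ f h : ι → ℂ, ∑ i, (w i : ℂ) * (star (f i) * L h i)
      = ∑ i, (w i : ℂ) * (star (L f i) * h i))
    (g : ℝ)
    (hg : ∀ (l : ℝ) (f : ι → ℂ), f ≠ 0 → ∑ i, (w i : ℂ) * f i = 0 →
      (∀ i, L f i = -(l : ℂ) * f i) → g ≤ l)
    (f : ι → ℂ) (hf : ∑ i, (w i : ℂ) * f i = 0) :
    g * ∑ i, w i * ‖f i‖ ^ 2 ≤ (∑ i, (w i : ℂ) * (star (f i) * -L f i)).re := by
  -- Multiplication by `√w` is an isometry onto the unweighted space.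
  set r : ι → ℂ := fun i => (Real.sqrt (w i) : ℂ) with hr
  have hr0 : ∀ i, r i ≠ 0 := fun i => by
    simpa [hr] using (Real.sqrt_pos.2 (hw i)).ne'
  have hrr : ∀ i, r i * r i = w i := fun i => by
    simp only [hr]
    rw [← Complex.ofReal_mul, Real.mul_self_sqrt (hw i).le]
  have hrs : ∀ i, star (r i) = r i := fun i => Complex.conj_ofReal _
  let U : EuclideanSpace ℂ ι →ₗ[ℂ] (ι → ℂ) :=
    { toFun := fun v i => (r i)⁻¹ * v i
      map_add' := fun u v => by funext i; simp [mul_add]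
      map_smul' := fun a v => by funext i; simp [mul_left_comm] }
  let D : (ι → ℂ) →ₗ[ℂ] EuclideanSpace ℂ ι :=
    { toFun := fun v => WithLp.toLp 2 fun i => r i * v i
      map_add' := fun u v => by ext i; simp [mul_add]
      map_smul' := fun a v => by ext i; simp [mul_left_comm] }
  have hU : ∀ (v : EuclideanSpace ℂ ι) i, U v i = (r i)⁻¹ * v i := fun _ _ => rfl
  have hD : ∀ (v : ι → ℂ) i, D v i = r i * v i := fun _ _ => rfl
  have hUD : ∀ v, U (D v) = v := fun v => by
    funext i; rw [hU, hD, inv_mul_cancel_left₀ (hr0 i)]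
  have hDU : ∀ v, D (U v) = v := fun v => by
    ext i; rw [hD, hU, mul_inv_cancel_left₀ (hr0 i)]
  have hin : ∀ u v : ι → ℂ, ⟪D u, D v⟫_ℂ = ∑ i, (w i : ℂ) * (star (u i) * v i) := fun u v => by
    rw [PiLp.inner_apply]
    refine Finset.sum_congr rfl fun i _ => ?_
    rw [RCLike.inner_apply, hD, hD, ← starRingEnd_apply, map_mul, starRingEnd_apply (r i), hrs,
      ← hrr]
    ring
  set T : EuclideanSpace ℂ ι →ₗ[ℂ] EuclideanSpace ℂ ι := -(D ∘ₗ L ∘ₗ U) with hTdef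
  have hT : ∀ v, T v = D (-L (U v)) := fun v => by simp [hTdef]
  have key := mul_norm_sq_le_re_inner_of_forall_eigenvector T ?_ (D fun _ => 1) ?_ g ?_ (D f) ?_
  · rw [hT, hUD, hin] at key
    refine le_trans (le_of_eq ?_) key
    congr 1
    rw [EuclideanSpace.norm_sq_eq]
    refine Finset.sum_congr rfl fun i _ => ?_
    rw [hD, norm_mul, mul_pow]
    congr 1
    rw [← norm_pow, sq, hrr, Complex.norm_real, Real.norm_of_nonneg (hw i).le]
  · intro u v
    rw [hT, hT, ← hDU u, ← hDU v, hUD, hUD, hin, hin]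
    have := hsymm (U u) (U v)
    simp only [Pi.neg_apply, star_neg, neg_mul, mul_neg, Finset.sum_neg_distrib, this]
  · rw [hT, hUD, hL1, neg_zero, map_zero]
  · intro μ v hv0 hv1 hv2
    refine hg μ (U v) ?_ ?_ fun i => ?_
    · intro h
      exact hv0 (by rw [← hDU v, h, map_zero])
    · rw [← hDU v, hin] at hv1
      simpa using hv1
    · have := congrArg (fun z => U z i) hv2
      simp only [hT, hUD, map_smul, Pi.smul_apply, smul_eq_mul, Pi.neg_apply] at this
      rw [neg_mul, ← this, neg_neg]
  · rw [hin]
    simpa using hf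

end Poincare

/-! ### Chords of a ring -/

section RingDistance

variable {N : ℕ}

/-- The chord `|sin (π (i - a) / N)|` between two sites of a ring of `N` sites. Away from
`i = a` it is an eigenfunction of the nearest-neighbour averaging in `i`, for the eigenvalue
`cos (π / N)`. -/
def chord (i a : Fin N) : ℝ := |Real.sin (Real.pi * ((i.val : ℝ) - a.val) / N)|

theorem chord_nonneg (i a : Fin N) : 0 ≤ chord i a := abs_nonneg _

theorem chord_comm (i a : Fin N) : chord i a = chord a i := by
  rw [chord, chord, ← abs_neg, ← Real.sin_neg]
  congr 2
  ring

theorem chord_pos {i a : Fin N} (h : i ≠ a) : 0 < chord i a := by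
  have key : ∀ b c : Fin N, c.val < b.val → 0 < chord b c := by
    intro b c hc
    have h1 : (c.val : ℝ) < b.val := by exact_mod_cast hc
    have h2 : (b.val : ℝ) < N := by exact_mod_cast b.isLt
    have h3 : (0 : ℝ) ≤ c.val := Nat.cast_nonneg _
    have hN : (0 : ℝ) < N := by linarith
    refine abs_pos.2 (Real.sin_pos_of_pos_of_lt_pi ?_ ?_).ne'
    · exact div_pos (mul_pos Real.pi_pos (by linarith)) hN
    · rw [div_lt_iff₀ hN]
      exact mul_lt_mul_of_pos_left (by linarith) Real.pi_pos
  rcases lt_or_gt_of_ne (fun e => h (Fin.ext e) : i.val ≠ a.val) with hlt | hlt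
  · rw [chord_comm]; exact key _ _ hlt
  · exact key _ _ hlt

/-- The sum of the chords over all ordered pairs of distinct points of `A`. -/
def chordSum (A : Finset (Fin N)) : ℝ := ∑ i ∈ A, ∑ a ∈ A.erase i, chord i a

/-- The value that `chordSum` would take if the point `j` of `A` moved to `i`, a point that
coincides with another one being counted twice. -/
def movedChordSum (A : Finset (Fin N)) (j i : Fin N) : ℝ :=
  chordSum (A.erase j) + 2 * ∑ a ∈ A.erase j, chord i a

theorem chordSum_nonneg (A : Finset (Fin N)) : 0 ≤ chordSum A :=
  Finset.sum_nonneg fun _ _ => Finset.sum_nonneg fun _ _ => chord_nonneg _ _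

theorem movedChordSum_nonneg (A : Finset (Fin N)) (j i : Fin N) : 0 ≤ movedChordSum A j i :=
  add_nonneg (chordSum_nonneg _)
    (mul_nonneg zero_le_two (Finset.sum_nonneg fun _ _ => chord_nonneg _ _))

theorem chordSum_pos {A : Finset (Fin N)} (hA : 2 ≤ A.card) : 0 < chordSum A := by
  obtain ⟨i, hi, a, ha, hne⟩ := Finset.one_lt_card.1 hA
  refine Finset.sum_pos' (fun _ _ => Finset.sum_nonneg fun _ _ => chord_nonneg _ _) ⟨i, hi, ?_⟩
  exact Finset.sum_pos' (fun _ _ => chord_nonneg _ _)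
    ⟨a, Finset.mem_erase.2 ⟨hne.symm, ha⟩, chord_pos hne⟩

theorem chordSum_insert {B : Finset (Fin N)} {i : Fin N} (hi : i ∉ B) :
    chordSum (insert i B) = chordSum B + 2 * ∑ a ∈ B, chord i a := by
  rw [chordSum, Finset.sum_insert hi, Finset.erase_insert hi]
  have h : ∀ b ∈ B, ∑ a ∈ (insert i B).erase b, chord b a
      = chord i b + ∑ a ∈ B.erase b, chord b a := by
    intro b hb
    have hib : i ≠ b := fun e => hi (e ▸ hb)
    rw [Finset.erase_insert_of_ne hib,
      Finset.sum_insert fun h => hi (Finset.mem_of_mem_erase h), chord_comm]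
  rw [Finset.sum_congr rfl h, Finset.sum_add_distrib, chordSum]
  ring

theorem chordSum_eq_movedChordSum {A : Finset (Fin N)} {j : Fin N} (hj : j ∈ A) :
    chordSum A = movedChordSum A j j := by
  conv_lhs => rw [← Finset.insert_erase hj]
  rw [chordSum_insert (Finset.notMem_erase j A), movedChordSum]

variable [NeZero N]

theorem exists_int_val_add_one (i : Fin N) :
    ∃ m : ℤ, ((i + 1 : Fin N).val : ℝ) = i.val + 1 - m * N := by
  refine ⟨((i.val + 1 : ℕ) / N : ℕ), ?_⟩
  have h : (i + 1 : Fin N).val = (i.val + 1) % N := by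
    rw [Fin.val_add, Fin.val_one', Nat.add_mod_mod]
  have h' : (i.val + 1) % N + N * ((i.val + 1) / N) = i.val + 1 := Nat.mod_add_div _ _
  have h'' : (((i.val + 1) % N : ℕ) : ℝ) + N * ((i.val + 1) / N : ℕ) = i.val + 1 := by
    exact_mod_cast h'
  rw [h, Int.cast_natCast]
  linarith

theorem abs_sin_sub_int_mul_pi (x : ℝ) (m : ℤ) : |Real.sin (x - m * Real.pi)| = |Real.sin x| := by
  rw [Real.sin_sub_int_mul_pi, abs_mul, abs_zpow, abs_neg, abs_one, one_zpow, one_mul]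

theorem chord_add_one (i a : Fin N) :
    chord (i + 1) a = |Real.sin (Real.pi * ((i.val : ℝ) - a.val) / N + Real.pi / N)| := by
  have hN : (N : ℝ) ≠ 0 := NeZero.ne _
  obtain ⟨m, hm⟩ := exists_int_val_add_one i
  rw [chord, hm, ← abs_sin_sub_int_mul_pi (_ + _) m]
  congr 2
  field_simp
  ring

theorem chord_sub_one (i a : Fin N) :
    chord (i - 1) a = |Real.sin (Real.pi * ((i.val : ℝ) - a.val) / N - Real.pi / N)| := by
  have hN : (N : ℝ) ≠ 0 := NeZero.ne _
  obtain ⟨m, hm⟩ := exists_int_val_add_one (i - 1)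
  rw [sub_add_cancel] at hm
  rw [chord, hm, ← abs_sin_sub_int_mul_pi (Real.pi * _ / _) m]
  congr 2
  field_simp
  ring

theorem chord_add_one_add_chord_sub_one {i a : Fin N} (h : i ≠ a) :
    chord (i + 1) a + chord (i - 1) a = 2 * Real.cos (Real.pi / N) * chord i a := by
  have hN : 0 < (N : ℝ) := Nat.cast_pos.2 (NeZero.pos N)
  have hpi := Real.pi_pos
  rw [chord_add_one, chord_sub_one, chord]
  have key : ∀ b c : ℕ, b < N → c < b →
      0 ≤ Real.sin (Real.pi * ((b : ℝ) - c) / N) ∧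
      0 ≤ Real.sin (Real.pi * ((b : ℝ) - c) / N + Real.pi / N) ∧
      0 ≤ Real.sin (Real.pi * ((b : ℝ) - c) / N - Real.pi / N) := by
    intro b c hb hc
    have h1 : (c : ℝ) + 1 ≤ b := by exact_mod_cast hc
    have h2 : (b : ℝ) + 1 ≤ N := by exact_mod_cast hb
    have h3 : (0 : ℝ) ≤ c := Nat.cast_nonneg c
    have aux : ∀ x : ℝ, 0 ≤ x → x ≤ N → 0 ≤ Real.sin (Real.pi * x / N) := fun x hx0 hx1 =>
      Real.sin_nonneg_of_nonneg_of_le_pi (by positivity)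
        (by rw [div_le_iff₀ hN]; exact mul_le_mul_of_nonneg_left hx1 hpi.le)
    refine ⟨aux _ (by linarith) (by linarith), ?_, ?_⟩
    · convert aux (b - c + 1) (by linarith) (by linarith) using 2
      ring
    · convert aux (b - c - 1) (by linarith) (by linarith) using 2
      ring
  rcases lt_or_gt_of_ne (fun e => h (Fin.ext e) : i.val ≠ a.val) with hlt | hlt
  · obtain ⟨k1, k2, k3⟩ := key a.val i.val a.isLt hlt
    have e : Real.pi * ((i.val : ℝ) - a.val) / N = -(Real.pi * ((a.val : ℝ) - i.val) / N) := by
      ring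
    have e1 : ∀ x y : ℝ, |Real.sin (-x + y)| = |Real.sin (x - y)| := fun x y => by
      rw [← abs_neg, ← Real.sin_neg]
      congr 2
      ring
    have e2 : ∀ x y : ℝ, |Real.sin (-x - y)| = |Real.sin (x + y)| := fun x y => by
      rw [← abs_neg, ← Real.sin_neg]
      congr 2
      ring
    rw [e, e1, e2, Real.sin_neg, abs_neg, abs_of_nonneg k1, abs_of_nonneg k2,
      abs_of_nonneg k3, Real.sin_add, Real.sin_sub]
    ring
  · obtain ⟨k1, k2, k3⟩ := key i.val a.val i.isLt hlt
    rw [abs_of_nonneg k1, abs_of_nonneg k2, abs_of_nonneg k3, Real.sin_add, Real.sin_sub]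
    ring

theorem sum_movedChordSum (A : Finset (Fin N)) :
    ∑ j ∈ A, (movedChordSum A j (j + 1) + movedChordSum A j (j - 1))
      = (2 * A.card + 4 * (Real.cos (Real.pi / N) - 1)) * chordSum A := by
  have h : ∀ j ∈ A, movedChordSum A j (j + 1) + movedChordSum A j (j - 1)
      = 2 * chordSum A + 4 * (Real.cos (Real.pi / N) - 1) * ∑ a ∈ A.erase j, chord j a := by
    intro j hj
    have hs : ∑ a ∈ A.erase j, chord (j + 1) a + ∑ a ∈ A.erase j, chord (j - 1) a
        = 2 * Real.cos (Real.pi / N) * ∑ a ∈ A.erase j, chord j a := by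
      rw [← Finset.sum_add_distrib, Finset.mul_sum]
      exact Finset.sum_congr rfl fun a ha =>
        chord_add_one_add_chord_sub_one (Finset.ne_of_mem_erase ha).symm
    rw [chordSum_eq_movedChordSum hj]
    simp only [movedChordSum]
    linear_combination 2 * hs
  rw [Finset.sum_congr rfl h, Finset.sum_add_distrib, Finset.sum_const, ← Finset.mul_sum,
    nsmul_eq_mul]
  change _ + _ * chordSum A = _
  ring

end RingDistance

/-! ### A maximum principle for annihilating random walks -/

section MaximumPrinciple

variable {α : Type*} [DecidableEq α]

theorem symmDiff_pair_eq_insert {A : Finset α} {j i : α} (hj : j ∈ A) (hi : i ∉ A.erase j) :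
    symmDiff A (symmDiff {j} {i}) = insert i (A.erase j) := by
  ext x
  simp only [Finset.mem_symmDiff, Finset.mem_singleton, Finset.mem_insert, Finset.mem_erase] at *
  by_cases h1 : x = j <;> by_cases h2 : x = i <;> by_cases h3 : x ∈ A <;> grind

theorem card_symmDiff_pair {A : Finset α} {j i : α} (hj : j ∈ A) (hi : i ∉ A.erase j) :
    (symmDiff A (symmDiff {j} {i})).card = A.card := by
  rw [symmDiff_pair_eq_insert hj hi, Finset.card_insert_of_notMem hi,
    Finset.card_erase_add_one hj]

theorem card_symmDiff_pair_lt {A : Finset α} {j i : α} (hj : j ∈ A) (hi : i ∈ A.erase j) :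
    (symmDiff A (symmDiff {j} {i})).card < A.card := by
  refine Finset.card_lt_card ⟨fun x hx => ?_, fun h => ?_⟩
  · simp only [Finset.mem_symmDiff, Finset.mem_singleton, Finset.mem_erase] at *
    grind
  · have := h hj
    simp only [Finset.mem_symmDiff, Finset.mem_singleton, Finset.mem_erase] at *
    grind

variable {N : ℕ} [NeZero N]

/-- The maximum principle for annihilating random walks on a ring. If the values `u A` vanish for
sets with fewer than `k` points and satisfy an eigenvalue equation on the sets of `k` points, and
if `h` is a positive function whose values after a move are dominated by `H`, then the eigenvalue
is controlled by the drift of `h`. The bound is read off at a set where `‖u‖ / h` is maximal. -/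
theorem eigenvalue_le_of_drift (k : ℕ) (u : Finset (Fin N) → ℂ) (m t κ : ℝ) (ht : 0 ≤ t)
    (hlow : ∀ A, A.card < k → u A = 0) (hne : ∃ A, A.card = k ∧ u A ≠ 0)
    (heig : ∀ A, A.card = k → (m : ℂ) * u A = 2 * t * ∑ j ∈ A,
      (u (symmDiff A (symmDiff {j} {j + 1})) + u (symmDiff A (symmDiff {j} {j - 1}))))
    (h : Finset (Fin N) → ℝ) (H : Finset (Fin N) → Fin N → Fin N → ℝ)
    (hpos : ∀ A, A.card = k → 0 < h A) (hH : ∀ A j i, 0 ≤ H A j i)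
    (hle : ∀ A j i, j ∈ A → i ∉ A.erase j → h (insert i (A.erase j)) ≤ H A j i)
    (hsum : ∀ A, A.card = k → ∑ j ∈ A, (H A j (j + 1) + H A j (j - 1)) ≤ κ * h A) :
    m ≤ 2 * t * κ := by
  obtain ⟨A₀, hA₀, hu₀⟩ := hne
  obtain ⟨A, hA, hmax⟩ := Finset.exists_max_image
    (Finset.univ.filter fun A : Finset (Fin N) => A.card = k) (fun A => ‖u A‖ / h A)
    ⟨A₀, by simpa using hA₀⟩
  simp only [Finset.mem_filter, Finset.mem_univ, true_and] at hA hmax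
  set M := ‖u A‖ / h A with hM
  have hMpos : 0 < M :=
    lt_of_lt_of_le (div_pos (norm_pos_iff.2 hu₀) (hpos _ hA₀)) (hmax _ hA₀)
  have huA : ‖u A‖ = M * h A := (div_mul_cancel₀ _ (hpos A hA).ne').symm
  have hstep : ∀ j ∈ A, ∀ i, ‖u (symmDiff A (symmDiff {j} {i}))‖ ≤ M * H A j i := by
    intro j hj i
    by_cases hi : i ∈ A.erase j
    · rw [hlow _ ((card_symmDiff_pair_lt hj hi).trans_eq hA), norm_zero]
      exact mul_nonneg hMpos.le (hH _ _ _)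
    · have hc := (card_symmDiff_pair hj hi).trans hA
      refine le_trans ?_ (mul_le_mul_of_nonneg_left (hle A j i hj hi) hMpos.le)
      rw [← symmDiff_pair_eq_insert hj hi, ← div_le_iff₀ (hpos _ hc)]
      exact hmax _ hc
  have h1 : m * (M * h A) ≤ 2 * t * (M * (κ * h A)) := by
    calc m * (M * h A) ≤ ‖(m : ℂ) * u A‖ := by
          rw [norm_mul, huA, Complex.norm_real]
          exact mul_le_mul_of_nonneg_right (le_abs_self m) (mul_pos hMpos (hpos A hA)).le
      _ = 2 * t * ‖∑ j ∈ A, (u (symmDiff A (symmDiff {j} {j + 1}))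
            + u (symmDiff A (symmDiff {j} {j - 1})))‖ := by
          rw [heig A hA, norm_mul, norm_mul, Complex.norm_real, Real.norm_of_nonneg ht]
          norm_num
      _ ≤ 2 * t * (M * ∑ j ∈ A, (H A j (j + 1) + H A j (j - 1))) := by
          refine mul_le_mul_of_nonneg_left ?_ (by positivity)
          rw [Finset.mul_sum]
          refine (norm_sum_le _ _).trans (Finset.sum_le_sum fun j hj => ?_)
          refine (norm_add_le _ _).trans ?_
          rw [mul_add]
          exact add_le_add (hstep j hj _) (hstep j hj _)
      _ ≤ 2 * t * (M * (κ * h A)) :=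
          mul_le_mul_of_nonneg_left (mul_le_mul_of_nonneg_left (hsum A hA) hMpos.le)
            (by positivity)
  refine le_of_mul_le_mul_right ?_ (mul_pos hMpos (hpos A hA))
  linarith

/-- The eigenvalues of the annihilating random walks started from at least one point, with an
additional decay rate `2` if the number of points is odd: a single walker gets the bound from the
additional rate, and two or more walkers get it from their annihilation, seen through the sum of
their mutual chords. -/
theorem eigenvalue_bound_of_annihilating_walks (k : ℕ) (hk : 1 ≤ k) (u : Finset (Fin N) → ℂ)
    (l t : ℝ) (ht : 0 ≤ t) (ht1 : t ≤ 1)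
    (hlow : ∀ A, A.card < k → u A = 0) (hne : ∃ A, A.card = k ∧ u A ≠ 0)
    (heig : ∀ A, A.card = k →
      ((4 * k + (1 - (-1) ^ k) - l : ℝ) : ℂ) * u A = 2 * t * ∑ j ∈ A,
        (u (symmDiff A (symmDiff {j} {j + 1})) + u (symmDiff A (symmDiff {j} {j - 1})))) :
    2 ≤ l ∨ 8 * (1 - t * Real.cos (Real.pi / N)) ≤ l := by
  rcases hk.eq_or_lt with rfl | hk2
  · left
    have := eigenvalue_le_of_drift 1 u _ t 2 ht hlow hne heig (fun _ => 1) (fun _ _ _ => 1)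
      (fun _ _ => one_pos) (fun _ _ _ => zero_le_one) (fun _ _ _ _ _ => le_rfl) (fun A hA => by
        rw [Finset.sum_const, hA]; norm_num)
    norm_num at this
    linarith
  · right
    have := eigenvalue_le_of_drift k u _ t (2 * k + 4 * (Real.cos (Real.pi / N) - 1)) ht hlow hne
      heig chordSum movedChordSum (fun A hA => chordSum_pos (hA ▸ hk2)) movedChordSum_nonneg
      (fun A j i _ hi => (chordSum_insert hi).le) (fun A hA => by rw [sum_movedChordSum, hA])
    have h1 : (-1 : ℝ) ^ k ≤ 1 := by
      rcases neg_one_pow_eq_or ℝ k with h | h <;> rw [h]; norm_num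
    have h2 : (2 : ℝ) ≤ k := by exact_mod_cast hk2
    nlinarith [mul_nonneg (sub_nonneg.2 h2) (sub_nonneg.2 ht1)]

end MaximumPrinciple

/-! ### Spin configurations -/

section Configurations

variable {N : ℕ}

/-- The configuration `s` with the spins in `A` flipped. -/
def flipOn (A : Finset (Fin N)) (s : Fin N → Fin 2) : Fin N → Fin 2 :=
  fun i => if i ∈ A then s i + 1 else s i

/-- The spin of the configuration `s` at site `i`: the eigenvalue `±1` of `σᶻ`. -/
def spin (s : Fin N → Fin 2) (i : Fin N) : ℝ := if s i = 0 then 1 else -1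

/-- The product of the spins in `A`. -/
def spinProd (A : Finset (Fin N)) (s : Fin N → Fin 2) : ℝ := ∏ i ∈ A, spin s i

theorem fin_two_add_one_add_one (a : Fin 2) : a + 1 + 1 = a := by
  fin_cases a <;> rfl

theorem flipOn_involutive (A : Finset (Fin N)) : Function.Involutive (flipOn A) := by
  intro s
  funext i
  by_cases h : i ∈ A <;> simp [flipOn, h, fin_two_add_one_add_one]

theorem spin_mul_self (s : Fin N → Fin 2) (i : Fin N) : spin s i * spin s i = 1 := by
  unfold spin
  split_ifs <;> norm_num

theorem spin_flipOn (A : Finset (Fin N)) (s : Fin N → Fin 2) (i : Fin N) :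
    spin (flipOn A s) i = (if i ∈ A then -1 else 1) * spin s i := by
  unfold spin flipOn
  by_cases h : i ∈ A
  · rcases Fin.exists_fin_two.1 ⟨s i, rfl⟩ with h0 | h0 <;> simp [h, h0]
  · simp [h]

theorem spinProd_mul (A B : Finset (Fin N)) (s : Fin N → Fin 2) :
    spinProd A s * spinProd B s = spinProd (symmDiff A B) s := by
  have h : ∀ C : Finset (Fin N), spinProd C s = ∏ i, if i ∈ C then spin s i else 1 := fun C => by
    rw [spinProd, Finset.prod_ite_mem, Finset.univ_inter]
  rw [h, h, h, ← Finset.prod_mul_distrib]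
  refine Finset.prod_congr rfl fun i _ => ?_
  by_cases hA : i ∈ A <;> by_cases hB : i ∈ B <;>
    simp [hA, hB, Finset.mem_symmDiff, spin_mul_self]

theorem spinProd_singleton (i : Fin N) (s : Fin N → Fin 2) : spinProd {i} s = spin s i :=
  Finset.prod_singleton _ _

theorem spinProd_flipOn_singleton (A : Finset (Fin N)) (j : Fin N) (s : Fin N → Fin 2) :
    spinProd A (flipOn {j} s) = (if j ∈ A then -1 else 1) * spinProd A s := by
  simp only [spinProd, spin_flipOn, Finset.mem_singleton, Finset.prod_mul_distrib,
    Finset.prod_ite_eq']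

theorem spinProd_flipOn_univ (A : Finset (Fin N)) (s : Fin N → Fin 2) :
    spinProd A (flipOn Finset.univ s) = (-1) ^ A.card * spinProd A s := by
  simp only [spinProd, spin_flipOn, Finset.mem_univ, if_true, Finset.prod_mul_distrib,
    Finset.prod_const]

/-- The products of spins span all functions of the configuration. -/
theorem eq_zero_of_forall_sum_mul_spinProd {f : (Fin N → Fin 2) → ℂ}
    (h : ∀ A, ∑ s, f s * (spinProd A s : ℂ) = 0) : f = 0 := by
  funext s'
  have hδ : ∀ s, ∑ A, (spinProd A s : ℂ) * (spinProd A s' : ℂ)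
      = if s = s' then (2 : ℂ) ^ N else 0 := by
    intro s
    have h1 : ∑ A : Finset (Fin N), spinProd A s * spinProd A s'
        = ∏ i, (1 + spin s i * spin s' i) := by
      rw [Finset.prod_one_add, Finset.powerset_univ]
      exact Finset.sum_congr rfl fun A _ => by
        rw [spinProd, spinProd, ← Finset.prod_mul_distrib]
    have h2 : ∏ i, (1 + spin s i * spin s' i) = if s = s' then (2 : ℝ) ^ N else 0 := by
      split_ifs with hs
      · subst hs
        simp only [spin_mul_self]
        rw [Finset.prod_const, Finset.card_univ, Fintype.card_fin]
        norm_num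
      · obtain ⟨i, hi⟩ := Function.ne_iff.1 hs
        refine Finset.prod_eq_zero (Finset.mem_univ i) ?_
        have : (s i = 0 ∧ s' i = 1) ∨ (s i = 1 ∧ s' i = 0) := by omega
        rcases this with ⟨a, b⟩ | ⟨a, b⟩ <;> simp [spin, a, b]
    have h3 := congrArg (fun x : ℝ => (x : ℂ)) (h1.trans h2)
    push_cast at h3
    rw [h3]
    split_ifs <;> norm_num
  have : ∑ A, (∑ s, f s * (spinProd A s : ℂ)) * (spinProd A s' : ℂ) = 2 ^ N * f s' := by
    simp only [Finset.sum_mul]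
    rw [Finset.sum_comm]
    simp only [mul_assoc, ← Finset.mul_sum, hδ, mul_ite, mul_zero, Finset.sum_ite_eq',
      Finset.mem_univ, if_true]
    ring
  simp only [h, zero_mul, Finset.sum_const_zero] at this
  simpa using this.symm

end Configurations

/-! ### Glauber dynamics on the ring and its dual -/

section Glauber

variable {N : ℕ} [NeZero N]

/-- The rate at which Glauber dynamics on the Ising ring flips the spin at site `j`; the parameter
`t` is `tanh (2βJ)` for a ring of at least two sites. -/
def flipRate (t : ℝ) (j : Fin N) (s : Fin N → Fin 2) : ℝ :=
  1 - t / 2 * (spin s j * (spin s (j + 1) + spin s (j - 1)))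

/-- The generator of the Glauber dynamics on the Ising ring, run at twice the rates `flipRate`
because both `σˣ` and `σʸ` flip a spin, with an additional simultaneous flip of all spins at
rate `1`. -/
def ringGlauber (N : ℕ) [NeZero N] (t : ℝ) :
    ((Fin N → Fin 2) → ℂ) →ₗ[ℂ] ((Fin N → Fin 2) → ℂ) where
  toFun f s := ∑ j, 2 * (flipRate t j s : ℂ) * (f (flipOn {j} s) - f s)
    + (f (flipOn Finset.univ s) - f s)
  map_add' f h := by
    funext s
    simp only [Pi.add_apply, add_sub_add_comm, mul_add, Finset.sum_add_distrib]
    ring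
  map_smul' a f := by
    funext s
    simp only [Pi.smul_apply, smul_eq_mul, RingHom.id_apply, ← mul_sub, mul_add, Finset.mul_sum]
    congr 1
    exact Finset.sum_congr rfl fun _ _ => by ring

theorem ringGlauber_apply (t : ℝ) (f : (Fin N → Fin 2) → ℂ) (s : Fin N → Fin 2) :
    ringGlauber N t f s = ∑ j, 2 * (flipRate t j s : ℂ) * (f (flipOn {j} s) - f s)
      + (f (flipOn Finset.univ s) - f s) := rfl

/-- Duality of the Glauber dynamics with annihilating random walks: the generator moves the
points of `A` to neighbouring sites, where two points that meet disappear. -/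
theorem ringGlauber_spinProd (t : ℝ) (A : Finset (Fin N)) (s : Fin N → Fin 2) :
    ringGlauber N t (fun s => (spinProd A s : ℂ)) s
      = 2 * t * ∑ j ∈ A, ((spinProd (symmDiff A (symmDiff {j} {j + 1})) s : ℂ)
            + (spinProd (symmDiff A (symmDiff {j} {j - 1})) s : ℂ))
        - ((4 * A.card + (1 - (-1) ^ A.card) : ℝ) : ℂ) * (spinProd A s : ℂ) := by
  have h : ∀ j, 2 * flipRate t j s * (spinProd A (flipOn {j} s) - spinProd A s)
      = if j ∈ A then 2 * t * (spinProd (symmDiff A (symmDiff {j} {j + 1})) s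
            + spinProd (symmDiff A (symmDiff {j} {j - 1})) s) - 4 * spinProd A s else 0 := by
    intro j
    rw [spinProd_flipOn_singleton]
    split_ifs
    · simp only [← spinProd_mul, spinProd_singleton, flipRate]
      ring
    · ring
  have hR : ∑ j, 2 * flipRate t j s * (spinProd A (flipOn {j} s) - spinProd A s)
      + (spinProd A (flipOn Finset.univ s) - spinProd A s)
      = 2 * t * ∑ j ∈ A, (spinProd (symmDiff A (symmDiff {j} {j + 1})) s
            + spinProd (symmDiff A (symmDiff {j} {j - 1})) s)
        - (4 * A.card + (1 - (-1) ^ A.card)) * spinProd A s := by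
    rw [Finset.sum_congr rfl fun j _ => h j, Finset.sum_ite_mem, Finset.univ_inter,
      Finset.sum_sub_distrib, ← Finset.mul_sum, Finset.sum_const, spinProd_flipOn_univ,
      nsmul_eq_mul]
    ring
  rw [ringGlauber_apply]
  have := congrArg (fun x : ℝ => (x : ℂ)) hR
  push_cast at this ⊢
  exact this

theorem sum_mul_star_mul_involution_sub {α : Type*} [Fintype α] (p : α → α)
    (hp : Function.Involutive p) (a : α → ℝ) (ha : ∀ s, a (p s) = a s) (f h : α → ℂ) :
    ∑ s, (a s : ℂ) * (star (f s) * (h (p s) - h s))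
      = ∑ s, (a s : ℂ) * (star (f (p s) - f s) * h s) := by
  have e : ∑ s, (a s : ℂ) * (star (f s) * h (p s)) = ∑ s, (a s : ℂ) * (star (f (p s)) * h s) := by
    rw [← Equiv.sum_comp hp.toPerm]
    refine Finset.sum_congr rfl fun s _ => ?_
    rw [hp.coe_toPerm, hp s, ha]
  simp only [mul_sub, star_sub, sub_mul, Finset.sum_sub_distrib, e]

theorem ringGlauber_symmetric (t : ℝ) (w : (Fin N → Fin 2) → ℝ)
    (hw1 : ∀ j s, w (flipOn {j} s) * flipRate t j (flipOn {j} s) = w s * flipRate t j s)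
    (hw2 : ∀ s, w (flipOn Finset.univ s) = w s) (f h : (Fin N → Fin 2) → ℂ) :
    ∑ s, (w s : ℂ) * (star (f s) * ringGlauber N t h s)
      = ∑ s, (w s : ℂ) * (star (ringGlauber N t f s) * h s) := by
  have hl : ∀ s, (w s : ℂ) * (star (f s) * ringGlauber N t h s)
      = ∑ j, ((2 * (w s * flipRate t j s) : ℝ) : ℂ) * (star (f s) * (h (flipOn {j} s) - h s))
        + (w s : ℂ) * (star (f s) * (h (flipOn Finset.univ s) - h s)) := fun s => by
    rw [ringGlauber_apply, mul_add, mul_add, Finset.mul_sum, Finset.mul_sum]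
    congr 1
    refine Finset.sum_congr rfl fun j _ => ?_
    push_cast
    ring
  have hr : ∀ s, (w s : ℂ) * (star (ringGlauber N t f s) * h s)
      = ∑ j, ((2 * (w s * flipRate t j s) : ℝ) : ℂ) * (star (f (flipOn {j} s) - f s) * h s)
        + (w s : ℂ) * (star (f (flipOn Finset.univ s) - f s) * h s) := fun s => by
    rw [ringGlauber_apply, star_add, star_sum, add_mul, mul_add, Finset.sum_mul, Finset.mul_sum]
    congr 1
    refine Finset.sum_congr rfl fun j _ => ?_
    rw [star_mul', star_mul']
    have h1 : star (flipRate t j s : ℂ) = flipRate t j s := Complex.conj_ofReal _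
    have h2 : star (2 : ℂ) = 2 := Complex.conj_ofNat _
    rw [h1, h2]
    push_cast
    ring
  simp only [hl, hr, Finset.sum_add_distrib]
  congr 1
  · refine (Finset.sum_comm.trans (Finset.sum_congr rfl fun j _ => ?_)).trans Finset.sum_comm
    exact
      sum_mul_star_mul_involution_sub _ (flipOn_involutive ({j} : Finset (Fin N))) _ (fun s => by rw [hw1]) f h
  · exact sum_mul_star_mul_involution_sub _ (flipOn_involutive _) _ hw2 f h

/-- The nonzero eigenvalues of the Glauber dynamics: the correlations `∑ₛ w s f s ∏_{i ∈ A} sᵢ` of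
an eigenfunction `f` with the products of spins solve, for the smallest sets `A` with a nonzero
correlation, the eigenvalue equation of annihilating random walks. -/
theorem ringGlauber_eigenvalue_bound (t : ℝ) (ht : 0 ≤ t) (ht1 : t ≤ 1)
    (w : (Fin N → Fin 2) → ℝ) (hw : ∀ s, 0 < w s)
    (hw1 : ∀ j s, w (flipOn {j} s) * flipRate t j (flipOn {j} s) = w s * flipRate t j s)
    (hw2 : ∀ s, w (flipOn Finset.univ s) = w s) (l : ℝ) (f : (Fin N → Fin 2) → ℂ) (hf : f ≠ 0)
    (hf0 : ∑ s, (w s : ℂ) * f s = 0) (hfl : ∀ s, ringGlauber N t f s = -(l : ℂ) * f s) :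
    2 ≤ l ∨ 8 * (1 - t * Real.cos (Real.pi / N)) ≤ l := by
  set u : Finset (Fin N) → ℂ := fun A => ∑ s, (w s : ℂ) * f s * (spinProd A s : ℂ) with hu
  have hex : ∃ A, u A ≠ 0 := by
    by_contra! hall
    refine hf ?_
    have := eq_zero_of_forall_sum_mul_spinProd (f := fun s => (w s : ℂ) * f s) hall
    funext s
    exact (mul_eq_zero.1 (congrFun this s)).resolve_left
      (Complex.ofReal_ne_zero.2 (hw s).ne')
  obtain ⟨A₀, hA₀, hmin⟩ := Finset.exists_min_image
    (Finset.univ.filter fun A : Finset (Fin N) => u A ≠ 0) Finset.card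
    (by obtain ⟨A, hA⟩ := hex; exact ⟨A, by simpa using hA⟩)
  simp only [Finset.mem_filter, Finset.mem_univ, true_and] at hA₀ hmin
  refine eigenvalue_bound_of_annihilating_walks A₀.card ?_ u l t ht ht1
    (fun A hA => by_contra fun h => absurd (hmin A h) (not_le.2 hA)) ⟨A₀, rfl, hA₀⟩ ?_
  · rw [Nat.one_le_iff_ne_zero, Finset.card_ne_zero, Finset.nonempty_iff_ne_empty]
    rintro rfl
    exact hA₀ (by simpa [hu, spinProd] using hf0)
  · intro A hA
    have h := ringGlauber_symmetric t w hw1 hw2 (fun s => (spinProd A s : ℂ)) f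
    have hreal : ∀ (B : Finset (Fin N)) (s : Fin N → Fin 2), star (spinProd B s : ℂ) = (spinProd B s : ℂ) :=
      fun B s => Complex.conj_ofReal _
    have hl : ∀ s, (w s : ℂ) * (star (spinProd A s : ℂ) * ringGlauber N t f s)
        = -(l : ℂ) * ((w s : ℂ) * f s * (spinProd A s : ℂ)) := fun s => by
      rw [hreal, hfl]; ring
    have hr : ∀ s, (w s : ℂ) *
          (star (ringGlauber N t (fun s => (spinProd A s : ℂ)) s) * f s)
        = 2 * t * ∑ j ∈ A,
            ((w s : ℂ) * f s * (spinProd (symmDiff A (symmDiff {j} {j + 1})) s : ℂ)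
              + (w s : ℂ) * f s * (spinProd (symmDiff A (symmDiff {j} {j - 1})) s : ℂ))
          - ((4 * A.card + (1 - (-1) ^ A.card) : ℝ) : ℂ)
            * ((w s : ℂ) * f s * (spinProd A s : ℂ)) := fun s => by
      have hst : star (ringGlauber N t (fun s => (spinProd A s : ℂ)) s)
          = ringGlauber N t (fun s => (spinProd A s : ℂ)) s := by
        rw [ringGlauber_spinProd]
        refine Complex.conj_eq_iff_real.2 ⟨2 * t * ∑ j ∈ A,
          (spinProd (symmDiff A (symmDiff {j} {j + 1})) s
            + spinProd (symmDiff A (symmDiff {j} {j - 1})) s)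
          - (4 * A.card + (1 - (-1) ^ A.card)) * spinProd A s, ?_⟩
        push_cast
        ring
      rw [hst, ringGlauber_spinProd]
      simp only [← mul_add, ← Finset.mul_sum]
      ring
    simp only [hl, hr, ← Finset.mul_sum, Finset.sum_sub_distrib] at h
    rw [Finset.sum_comm] at h
    simp only [Finset.sum_add_distrib] at h ⊢
    change -(l : ℂ) * u A = _ - _ * u A at h
    rw [← hA]
    rw [Complex.ofReal_sub, sub_mul]
    linear_combination h

end Glauber

/-! ### Detailed balance -/

section DetailedBalance

variable {n : Type*} [Fintype n] [DecidableEq n]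

theorem glauberRate_pos (β ω : ℝ) : 0 < glauberRate β ω := by
  unfold glauberRate
  positivity

theorem glauberRate_zero (β : ℝ) : glauberRate β 0 = 1 := by
  norm_num [glauberRate]

theorem exp_mul_glauberRate_comm (β a b : ℝ) :
    Real.exp (-β * a) * glauberRate β (b - a) = Real.exp (-β * b) * glauberRate β (a - b) := by
  have h : ∀ x y : ℝ, Real.exp (-β * x) * glauberRate β (y - x)
      = 2 / (Real.exp (β * y) + Real.exp (β * x)) := fun x y => by
    have e1 : Real.exp (β * y) = Real.exp (β * (y - x)) * Real.exp (β * x) := by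
      rw [← Real.exp_add]; congr 1; ring
    have e2 : Real.exp (-β * x) * Real.exp (β * x) = 1 := by
      rw [← Real.exp_add]; simp
    rw [glauberRate, e1, eq_div_iff (by positivity), mul_div_assoc', div_mul_eq_mul_div,
      div_eq_iff (by positivity)]
    linear_combination 2 * (Real.exp (β * (y - x)) + 1) * e2
  rw [h, h, add_comm]

theorem gnsInner_diagonal (w : n → ℝ) (Y X : Matrix n n ℂ) :
    (gnsInner (Matrix.diagonal fun s => (w s : ℂ)) Y X).re
      = ∑ q : n × n, w q.2 * (star (Y q.1 q.2) * X q.1 q.2).re := by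
  rw [gnsInner, Matrix.trace, Complex.re_sum, Fintype.sum_prod_type_right]
  refine Finset.sum_congr rfl fun s _ => ?_
  rw [Matrix.diag_apply, Matrix.mul_diagonal, Matrix.mul_apply, mul_comm, Complex.re_ofReal_mul,
    Complex.re_sum, Finset.mul_sum]
  rfl

theorem sum_prod_eq_sum_offDiag_add_sum_diag (F : n × n → ℝ) :
    ∑ q, F q = ∑ q : n × n, (if q.1 = q.2 then 0 else F q) + ∑ s, F (s, s) := by
  have h : ∀ q : n × n, F q
      = (if q.1 = q.2 then 0 else F q) + (if q.1 = q.2 then F q else 0) := fun q => by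
    split_ifs <;> simp
  rw [Finset.sum_congr rfl fun q _ => h q, Finset.sum_add_distrib]
  congr 1
  simp [Fintype.sum_prod_type]

/-- The part of the Dirichlet form of a monomial coupling that involves the off-diagonal entries
is nonnegative: by detailed balance, the terms at `(t, s)` and `(p t, p s)` add up to a nonnegative
quantity. -/
theorem sum_offDiag_davies_nonneg (E : n → ℝ) (β K : ℝ) (hK : 0 ≤ K) (p : n → n)
    (hp : Function.Involutive p) (c : n → ℂ) (hc : ∀ s, star (c s) * c s = 1)
    (X : Matrix n n ℂ) :
    0 ≤ ∑ q : n × n, if q.1 = q.2 then 0 else Real.exp (-β * E q.2) * K *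
      (star (X q.1 q.2) * -davies (Matrix.diagonal fun s => (E s : ℂ)) β
        (Matrix.of fun t s => if t = p s then c s else 0) X q.1 q.2).re := by
  have hcn : ∀ s, ‖c s‖ = 1 := fun s => by
    have h := congrArg norm (hc s)
    rw [norm_mul, norm_star, norm_one] at h
    nlinarith [norm_nonneg (c s)]
  set r : n × n → ℝ := fun q =>
    if E (p q.1) - E q.1 = E (p q.2) - E q.2 then glauberRate β (E (p q.2) - E q.2) else 0 with hr
  have hr0 : ∀ q, 0 ≤ r q := fun q => by
    simp only [hr]
    split_ifs
    exacts [(glauberRate_pos _ _).le, le_rfl]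
  set b : n × n → ℝ := fun q => if q.1 = q.2 then 0 else Real.exp (-β * E q.2) * K * r q with hb
  set P : n × n → n × n := fun q => (p q.1, p q.2) with hP
  have hPi : Function.Involutive P := fun q => by simp [hP, hp q.1, hp q.2]
  have hbP : ∀ q, b (P q) = b q := by
    rintro ⟨t, s⟩
    simp only [hb, hP, hr, hp.injective.eq_iff, hp t, hp s]
    have e1 : (E t - E (p t) = E s - E (p s)) ↔ (E (p t) - E t = E (p s) - E s) := by
      constructor <;> intro h <;> linarith
    simp only [e1]
    split_ifs
    · rfl
    · rw [mul_right_comm, ← exp_mul_glauberRate_comm, mul_right_comm]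
    · simp
  have hzero : ∑ q, (1 / 2) * b q * (‖X q.1 q.2‖ ^ 2 - ‖X (P q).1 (P q).2‖ ^ 2) = 0 := by
    have e : ∑ q, b q * ‖X (P q).1 (P q).2‖ ^ 2 = ∑ q, b q * ‖X q.1 q.2‖ ^ 2 := by
      rw [← Equiv.sum_comp hPi.toPerm]
      refine Finset.sum_congr rfl fun q _ => ?_
      rw [hPi.coe_toPerm, hPi q, hbP]
    simp only [mul_assoc, ← Finset.mul_sum, mul_sub, Finset.sum_sub_distrib, e, sub_self]
  refine hzero.symm.le.trans (Finset.sum_le_sum ?_)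
  rintro ⟨t, s⟩ -
  by_cases hts : t = s
  · simp [hb, hts]
  · simp only [hb, hP, if_neg hts]
    rw [davies_diagonal_apply E β p hp c hc]
    set gt := glauberRate β (E (p t) - E t) with hgt
    set gs := glauberRate β (E (p s) - E s) with hgs
    set x := X t s
    set y := X (p t) (p s)
    have hcoef : (if E (p t) - E t = E (p s) - E s then (gs : ℂ) else 0) = (r (t, s) : ℂ) := by
      simp only [hr, apply_ite (Complex.ofReal), Complex.ofReal_zero, hgs]
    have hrle : r (t, s) ≤ (gt + gs) / 2 := by
      simp only [hr]
      split_ifs with h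
      · rw [hgt, hgs, h]; linarith
      · rw [hgt, hgs]
        linarith [glauberRate_pos β (E (p t) - E t), glauberRate_pos β (E (p s) - E s)]
    rw [hcoef]
    have hre : (star x * -((r (t, s) : ℂ) * (star (c t) * c s) * y
          - (1 / 2 : ℂ) * (gt + gs) * x)).re
        = (gt + gs) / 2 * ‖x‖ ^ 2 - r (t, s) * (star x * (star (c t) * c s) * y).re := by
      have e : star x * -((r (t, s) : ℂ) * (star (c t) * c s) * y
          - (1 / 2 : ℂ) * (gt + gs) * x)
          = (((gt + gs) / 2 * ‖x‖ ^ 2 : ℝ) : ℂ)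
            - (r (t, s) : ℂ) * (star x * (star (c t) * c s) * y) := by
        have hx : star x * x = ((‖x‖ ^ 2 : ℝ) : ℂ) := by
          rw [← Complex.normSq_eq_norm_sq, Complex.normSq_eq_conj_mul_self]; rfl
        rw [Complex.ofReal_mul, ← hx]
        push_cast
        ring
      rw [e, Complex.sub_re, Complex.ofReal_re, Complex.re_ofReal_mul]
    have hn : (star x * (star (c t) * c s) * y).re ≤ ‖x‖ * ‖y‖ := by
      refine (Complex.re_le_norm _).trans (le_of_eq ?_)
      rw [norm_mul, norm_mul, norm_mul, norm_star, norm_star, hcn, hcn, mul_one, mul_one]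
    rw [hre, mul_comm (1 / 2 : ℝ), mul_assoc, mul_assoc]
    refine mul_le_mul_of_nonneg_left ?_ (by positivity)
    have h1 := mul_le_mul_of_nonneg_right hrle (sq_nonneg ‖x‖)
    have h2 := mul_le_mul_of_nonneg_left hn (hr0 (t, s))
    have h3 := mul_nonneg (hr0 (t, s)) (sq_nonneg (‖x‖ - ‖y‖))
    nlinarith

theorem davies_diagonal_apply_self (E : n → ℝ) (β : ℝ) (p : n → n) (hp : Function.Involutive p)
    (c : n → ℂ) (hc : ∀ s, star (c s) * c s = 1) (X : Matrix n n ℂ) (s : n) :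
    davies (Matrix.diagonal fun s => (E s : ℂ)) β
        (Matrix.of fun t s => if t = p s then c s else 0) X s s
      = glauberRate β (E (p s) - E s) * (X (p s) (p s) - X s s) := by
  rw [davies_diagonal_apply E β p hp c hc, if_pos rfl, hc]
  ring

end DetailedBalance

/-! ### The Ising ring -/

section IsingRing

variable {N : ℕ}

theorem eq_flipOn_singleton_iff (j : Fin N) (t s : Fin N → Fin 2) :
    t = flipOn {j} s ↔ (∀ i, i ≠ j → t i = s i) ∧ t j = s j + 1 := by
  constructor
  · rintro rfl
    exact ⟨fun i hi => by simp [flipOn, hi], by simp [flipOn]⟩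
  · rintro ⟨h1, h2⟩
    funext i
    by_cases hi : i = j
    · subst hi; simpa [flipOn] using h2
    · simpa [flipOn, hi] using h1 i hi

theorem onSite_pauliX (j : Fin N) :
    onSite j pauliX = Matrix.of fun t s => if t = flipOn {j} s then (1 : ℂ) else 0 := by
  ext t s
  simp only [onSite, Matrix.of_apply, eq_flipOn_singleton_iff]
  by_cases h : ∀ i, i ≠ j → t i = s i
  · simp only [eq_true h, if_true, true_and]
    generalize t j = a
    generalize s j = b
    fin_cases a <;> fin_cases b <;> simp [pauliX]
  · simp [h]

theorem onSite_pauliY (j : Fin N) :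
    onSite j pauliY = Matrix.of fun t s =>
      if t = flipOn {j} s then (if s j = 0 then Complex.I else -Complex.I) else 0 := by
  ext t s
  simp only [onSite, Matrix.of_apply, eq_flipOn_singleton_iff]
  by_cases h : ∀ i, i ≠ j → t i = s i
  · simp only [eq_true h, if_true, true_and]
    generalize t j = a
    generalize s j = b
    fin_cases a <;> fin_cases b <;> simp [pauliY]
  · simp [h]

theorem onSite_pauliZ (j : Fin N) :
    onSite j pauliZ = Matrix.of fun t s => if t = id s then (spin s j : ℂ) else 0 := by
  ext t s
  have e : t = id s ↔ (∀ i, i ≠ j → t i = s i) ∧ t j = s j := by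
    constructor
    · rintro rfl
      simp
    · rintro ⟨h1, h2⟩
      funext i
      by_cases hi : i = j
      · subst hi; exact h2
      · exact h1 i hi
  simp only [onSite, Matrix.of_apply, e, spin]
  by_cases h : ∀ i, i ≠ j → t i = s i
  · simp only [eq_true h, if_true, true_and]
    generalize t j = a
    generalize s j = b
    fin_cases a <;> fin_cases b <;> simp [pauliZ]
  · simp [h]

theorem onSite_pauliZ_eq_diagonal (j : Fin N) :
    onSite j pauliZ = Matrix.diagonal fun s => (spin s j : ℂ) := by
  rw [onSite_pauliZ]
  ext t s
  by_cases h : t = s <;> simp [h]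

theorem globalX_eq (N : ℕ) :
    globalX N = Matrix.of fun t s => if t = flipOn Finset.univ s then (1 : ℂ) else 0 := by
  have h : ∀ l : List (Fin N), l.Nodup →
      (l.map fun j => onSite j pauliX).prod
        = Matrix.of fun t s => if t = flipOn l.toFinset s then (1 : ℂ) else 0 := by
    intro l
    induction l with
    | nil =>
      intro _
      ext t s
      have h0 : flipOn ∅ s = s := by
        funext i
        simp [flipOn]
      simp [Matrix.one_apply, h0]
    | cons j l ih =>
      intro hl
      rw [List.nodup_cons] at hl
      rw [List.map_cons, List.prod_cons, ih hl.2, onSite_pauliX]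
      ext t s
      have hf : flipOn {j} (flipOn l.toFinset s) = flipOn (j :: l).toFinset s := by
        funext i
        by_cases hi : i = j
        · subst hi
          simp [flipOn, hl.1]
        · simp [flipOn, hi]
      simp only [Matrix.mul_apply, Matrix.of_apply, mul_ite, mul_one, mul_zero,
        Finset.sum_ite_eq', Finset.mem_univ, if_true, hf]
  rw [globalX, List.ofFn_eq_map, h _ (List.nodup_finRange N), List.toFinset_finRange]

variable [NeZero N]

/-- The energy `-J ∑ⱼ sⱼ sⱼ₊₁` of a configuration of the ring. -/
def ringEnergy (J : ℝ) (s : Fin N → Fin 2) : ℝ := -J * ∑ j, spin s j * spin s (j + 1)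

theorem isingHamiltonian_eq_diagonal (J : ℝ) :
    isingHamiltonian N J = Matrix.diagonal fun s => (ringEnergy J s : ℂ) := by
  have h : ∑ j : Fin N, onSite j pauliZ * onSite (j + 1) pauliZ
      = Matrix.diagonal fun s => ∑ j, ((spin s j : ℂ) * (spin s (j + 1) : ℂ)) := by
    simp only [onSite_pauliZ_eq_diagonal, Matrix.diagonal_mul_diagonal]
    ext t s
    rw [Matrix.sum_apply]
    by_cases hts : t = s <;> simp [hts]
  rw [isingHamiltonian, h, ← Matrix.diagonal_smul]
  congr 1
  funext s
  simp [ringEnergy]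

theorem ringEnergy_flipOn_univ (J : ℝ) (s : Fin N → Fin 2) :
    ringEnergy J (flipOn Finset.univ s) = ringEnergy J s := by
  simp [ringEnergy, spin_flipOn]

theorem ringEnergy_flipOn_singleton_sub (hN : 2 ≤ N) (J : ℝ) (j : Fin N) (s : Fin N → Fin 2) :
    ringEnergy J (flipOn {j} s) - ringEnergy J s
      = 2 * J * (spin s j * spin s (j + 1) + spin s j * spin s (j - 1)) := by
  have h1 : ∀ i : Fin N, i + 1 ≠ i := fun i h => by
    have h0 : (1 : Fin N) = 0 := by simpa using h
    have := congrArg Fin.val h0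
    rw [Fin.val_one', Nat.mod_eq_of_lt (by omega)] at this
    simp at this
  have hterm : ∀ i, spin (flipOn {j} s) i * spin (flipOn {j} s) (i + 1)
      = spin s i * spin s (i + 1)
        + ((if i = j then -2 * (spin s i * spin s (i + 1)) else 0)
          + (if i = j - 1 then -2 * (spin s i * spin s (i + 1)) else 0)) := by
    intro i
    rw [spin_flipOn, spin_flipOn]
    simp only [Finset.mem_singleton, ← eq_sub_iff_add_eq]
    by_cases ha : i = j <;> by_cases hb : i = j - 1
    · exact absurd (by rw [← ha] at hb; exact (eq_sub_iff_add_eq.1 hb)) (h1 i)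
    · simp only [if_pos ha, if_neg hb]
      ring
    · simp only [if_neg ha, if_pos hb]
      ring
    · simp only [if_neg ha, if_neg hb]
      ring
  simp only [ringEnergy, hterm, Finset.sum_add_distrib, Finset.sum_ite_eq', Finset.mem_univ,
    if_true, sub_add_cancel]
  ring

/-- The parameter of the Glauber dynamics: `tanh (2βJ)`, except for the ring of a single site,
where a spin flip does not change the energy. -/
def ringParam (N : ℕ) (J β : ℝ) : ℝ :=
  if 2 ≤ N then 1 - 2 / (Real.exp (4 * β * J) + 1) else 0

theorem glauberRate_ringEnergy (J β : ℝ) (j : Fin N) (s : Fin N → Fin 2) :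
    glauberRate β (ringEnergy J (flipOn {j} s) - ringEnergy J s)
      = flipRate (ringParam N J β) j s := by
  by_cases hN : 2 ≤ N
  · rw [ringEnergy_flipOn_singleton_sub hN, ringParam, if_pos hN, flipRate]
    have hsp : ∀ i, spin s i = 1 ∨ spin s i = -1 := fun i => by
      unfold spin
      split_ifs <;> simp
    have g1 : glauberRate β (4 * J) = 2 / (Real.exp (4 * β * J) + 1) := by
      rw [glauberRate]; congr 3; ring
    have g2 : glauberRate β (-(4 * J)) = 2 - 2 / (Real.exp (4 * β * J) + 1) := by
      have e : β * -(4 * J) = -(4 * β * J) := by ring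
      rw [glauberRate, e, Real.exp_neg]
      field_simp
      ring
    have e0 : ∀ a b c : ℝ, (a * b + a * c = 0 → glauberRate β (2 * J * (a * b + a * c)) = 1) :=
      fun a b c h => by rw [h, mul_zero, glauberRate_zero]
    rcases hsp j with ha | ha <;> rcases hsp (j + 1) with hb | hb <;>
      rcases hsp (j - 1) with hc | hc <;> rw [ha, hb, hc]
    all_goals first
      | (rw [e0 _ _ _ (by norm_num)]; ring1)
      | (rw [show 2 * J * ((1 : ℝ) * 1 + 1 * 1) = 4 * J by ring1, g1]; ring1)
      | (rw [show 2 * J * ((-1 : ℝ) * -1 + -1 * -1) = 4 * J by ring1, g1]; ring1)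
      | (rw [show 2 * J * ((1 : ℝ) * -1 + 1 * -1) = -(4 * J) by ring1, g2]; ring1)
      | (rw [show 2 * J * ((-1 : ℝ) * 1 + -1 * 1) = -(4 * J) by ring1, g2]; ring1)
  · have h1 : N = 1 := by have := NeZero.pos N; omega
    subst h1
    have hu : ({j} : Finset (Fin 1)) = Finset.univ := by
      ext i
      exact iff_of_true (Finset.mem_singleton.2 (Subsingleton.elim i j)) (Finset.mem_univ i)
    rw [hu, ringEnergy_flipOn_univ, sub_self, glauberRate_zero, flipRate, ringParam, if_neg hN]
    ring

end IsingRing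

/-! ### The spectral gap of the Ising ring -/

section Gap

theorem re_star_mul_self (z : ℂ) : (star z * z).re = ‖z‖ ^ 2 := by
  rw [← Complex.normSq_eq_norm_sq]
  exact congrArg Complex.re (Complex.normSq_eq_conj_mul_self).symm

variable {N : ℕ}

theorem star_mul_self_pauliY_coeff (j : Fin N) (s : Fin N → Fin 2) :
    star (if s j = 0 then Complex.I else -Complex.I)
      * (if s j = 0 then Complex.I else -Complex.I) = 1 := by
  split_ifs <;> simp

theorem star_mul_self_spin (j : Fin N) (s : Fin N → Fin 2) :
    star (spin s j : ℂ) * (spin s j : ℂ) = 1 := by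
  have h : star (spin s j : ℂ) = spin s j := Complex.conj_ofReal _
  rw [h, ← Complex.ofReal_mul, spin_mul_self, Complex.ofReal_one]

theorem two_le_sum_one_sub_spin_mul_spin {t s : Fin N → Fin 2} (h : t ≠ s) :
    2 ≤ ∑ j, (1 - spin t j * spin s j) := by
  obtain ⟨i, hi⟩ := Function.ne_iff.1 h
  have hnn : ∀ j ∈ Finset.univ, 0 ≤ 1 - spin t j * spin s j := fun j _ => by
    unfold spin
    split_ifs <;> norm_num
  refine le_trans (le_of_eq ?_) (Finset.single_le_sum hnn (Finset.mem_univ i))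
  have : (t i = 0 ∧ s i = 1) ∨ (t i = 1 ∧ s i = 0) := by omega
  rcases this with ⟨a, b⟩ | ⟨a, b⟩ <;> norm_num [spin, a, b]

theorem ringParam_nonneg {J β : ℝ} (hJ : 0 < J) (hβ : 0 < β) : 0 ≤ ringParam N J β := by
  rw [ringParam]
  split_ifs
  · have := Real.one_le_exp (x := 4 * β * J) (by positivity)
    rw [sub_nonneg, div_le_one (by positivity)]
    linarith
  · exact le_rfl

theorem ringParam_le (J β : ℝ) :
    ringParam N J β ≤ 1 - 2 / (Real.exp (4 * β * J) + 1) ∨ ringParam N J β = 0 := by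
  rw [ringParam]
  split_ifs
  · exact Or.inl le_rfl
  · exact Or.inr rfl

/-- The lower bound `max {2 exp (-4βJ), 2 / N²}` for the spectral gap. -/
def gapBound (N : ℕ) (J β : ℝ) : ℝ :=
  max (2 * Real.exp (-4 * β * J)) (2 * ((N : ℝ) ^ 2)⁻¹)

theorem gapBound_pos (J β : ℝ) : 0 < gapBound N J β :=
  lt_max_of_lt_left (by positivity)

variable [NeZero N]

/-- On the diagonal entries of an observable the Davies generator acts as Glauber dynamics. -/
theorem isingDavies_apply_self (J β : ℝ) (X : QubitOp N) (s : Fin N → Fin 2) :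
    isingDavies N J β X s s = ringGlauber N (ringParam N J β) (fun s => X s s) s := by
  simp only [isingDavies, Matrix.add_apply, Matrix.sum_apply, isingHamiltonian_eq_diagonal]
  rw [globalX_eq, davies_diagonal_apply_self _ _ _ (flipOn_involutive _) _ (fun _ => by simp),
    ringEnergy_flipOn_univ, sub_self, glauberRate_zero, ringGlauber_apply]
  congr 1
  · refine Finset.sum_congr rfl fun j _ => ?_
    rw [onSite_pauliX, onSite_pauliY, onSite_pauliZ,
      davies_diagonal_apply_self _ _ _ (flipOn_involutive _) _ (fun _ => by simp),
      davies_diagonal_apply_self _ _ _ (flipOn_involutive _) _ (star_mul_self_pauliY_coeff j),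
      davies_diagonal_apply_self _ _ _ (fun _ => rfl) _ (star_mul_self_spin j),
      glauberRate_ringEnergy]
    simp only [id]
    ring
  · rw [Complex.ofReal_one, one_mul]

theorem davies_onSite_pauliZ_apply (J β : ℝ) (j : Fin N) (X : QubitOp N) (t s : Fin N → Fin 2) :
    davies (isingHamiltonian N J) β (onSite j pauliZ) X t s
      = ((spin t j * spin s j - 1 : ℝ) : ℂ) * X t s := by
  rw [isingHamiltonian_eq_diagonal, onSite_pauliZ,
    davies_diagonal_apply _ _ _ (fun _ => rfl) _ (star_mul_self_spin j)]
  have h : star (spin t j : ℂ) = spin t j := Complex.conj_ofReal _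
  simp only [id, sub_self, if_true, glauberRate_zero, h]
  push_cast
  ring

/-- The off-diagonal entries contribute at least twice their norm to the Dirichlet form: the
couplings `σᶻ` dephase each of them with rate at least `2`, and no coupling contributes a negative
amount. -/
theorem two_mul_sum_offDiag_le (J β K : ℝ) (hK : 0 ≤ K) (X : QubitOp N) :
    2 * ∑ q : (Fin N → Fin 2) × (Fin N → Fin 2), (if q.1 = q.2 then 0 else
        Real.exp (-β * ringEnergy J q.2) * K * ‖X q.1 q.2‖ ^ 2)
      ≤ ∑ q : (Fin N → Fin 2) × (Fin N → Fin 2), if q.1 = q.2 then 0 else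
        Real.exp (-β * ringEnergy J q.2) * K *
          (star (X q.1 q.2) * -isingDavies N J β X q.1 q.2).re := by
  set F : QubitOp N → ℝ := fun Y =>
    ∑ q : (Fin N → Fin 2) × (Fin N → Fin 2), if q.1 = q.2 then 0 else
      Real.exp (-β * ringEnergy J q.2) * K * (star (X q.1 q.2) * -Y q.1 q.2).re with hF
  have hadd : ∀ Y Z, F (Y + Z) = F Y + F Z := fun Y Z => by
    simp only [hF, ← Finset.sum_add_distrib]
    refine Finset.sum_congr rfl fun q _ => ?_
    split_ifs
    · simp
    · rw [Matrix.add_apply, neg_add, mul_add, Complex.add_re, mul_add]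
  have hsum : ∀ Y : Fin N → QubitOp N, F (∑ j, Y j) = ∑ j, F (Y j) := fun Y => by
    have h0 : F 0 = 0 := by simp [hF]
    exact map_sum (⟨⟨F, h0⟩, hadd⟩ : QubitOp N →+ ℝ) Y Finset.univ
  have hX : ∀ j, 0 ≤ F (davies (isingHamiltonian N J) β (onSite j pauliX) X) := fun j => by
    rw [isingHamiltonian_eq_diagonal, onSite_pauliX]
    exact sum_offDiag_davies_nonneg _ β K hK _ (flipOn_involutive _) _ (fun _ => by simp) X
  have hY : ∀ j, 0 ≤ F (davies (isingHamiltonian N J) β (onSite j pauliY) X) := fun j => by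
    rw [isingHamiltonian_eq_diagonal, onSite_pauliY]
    exact sum_offDiag_davies_nonneg _ β K hK _ (flipOn_involutive _) _
      (star_mul_self_pauliY_coeff j) X
  have hG : 0 ≤ F (davies (isingHamiltonian N J) β (globalX N) X) := by
    rw [isingHamiltonian_eq_diagonal, globalX_eq]
    exact sum_offDiag_davies_nonneg _ β K hK _ (flipOn_involutive _) _ (fun _ => by simp) X
  have hZ : 2 * ∑ q : (Fin N → Fin 2) × (Fin N → Fin 2), (if q.1 = q.2 then 0 else
        Real.exp (-β * ringEnergy J q.2) * K * ‖X q.1 q.2‖ ^ 2)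
      ≤ ∑ j, F (davies (isingHamiltonian N J) β (onSite j pauliZ) X) := by
    simp only [hF]
    rw [Finset.sum_comm, Finset.mul_sum]
    refine Finset.sum_le_sum fun q _ => ?_
    by_cases hq : q.1 = q.2
    · simp [hq]
    · simp only [if_neg hq]
      have e : ∀ j, (star (X q.1 q.2) *
          -davies (isingHamiltonian N J) β (onSite j pauliZ) X q.1 q.2).re
          = (1 - spin q.1 j * spin q.2 j) * ‖X q.1 q.2‖ ^ 2 := fun j => by
        have e1 : star (X q.1 q.2) *
            -(((spin q.1 j * spin q.2 j - 1 : ℝ) : ℂ) * X q.1 q.2)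
            = ((1 - spin q.1 j * spin q.2 j : ℝ) : ℂ) * (star (X q.1 q.2) * X q.1 q.2) := by
          push_cast
          ring
        rw [davies_onSite_pauliZ_apply, e1, Complex.re_ofReal_mul, re_star_mul_self]
      simp only [e]
      rw [← Finset.mul_sum, ← Finset.sum_mul, mul_left_comm]
      refine mul_le_mul_of_nonneg_left ?_ (by positivity)
      exact mul_le_mul_of_nonneg_right (two_le_sum_one_sub_spin_mul_spin hq) (by positivity)
  change _ ≤ F (isingDavies N J β X)
  rw [isingDavies, hadd, hsum]
  simp only [hadd, Finset.sum_add_distrib]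
  have h1 := Finset.sum_nonneg fun j (_ : j ∈ Finset.univ) => hX j
  have h2 := Finset.sum_nonneg fun j (_ : j ∈ Finset.univ) => hY j
  linarith

theorem gapBound_le_two {J β : ℝ} (hJ : 0 < J) (hβ : 0 < β) : gapBound N J β ≤ 2 := by
  have hN : (1 : ℝ) ≤ N := by exact_mod_cast NeZero.one_le
  refine max_le ?_ ?_
  · have : Real.exp (-4 * β * J) ≤ 1 := Real.exp_le_one_iff.2 (by nlinarith [mul_pos hβ hJ])
    linarith
  · have : ((N : ℝ) ^ 2)⁻¹ ≤ 1 := inv_le_one_of_one_le₀ (one_le_pow₀ hN)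
    linarith

theorem gapBound_le {J β : ℝ} (hJ : 0 < J) (hβ : 0 < β) :
    gapBound N J β ≤ 8 * (1 - ringParam N J β * Real.cos (Real.pi / N)) := by
  have hN : (1 : ℝ) ≤ N := by exact_mod_cast NeZero.one_le
  have ht := ringParam_nonneg (N := N) hJ hβ
  have hexp : Real.exp (-4 * β * J) ≤ 1 := Real.exp_le_one_iff.2 (by nlinarith [mul_pos hβ hJ])
  have hprod : Real.exp (-4 * β * J) * Real.exp (4 * β * J) = 1 := by
    rw [← Real.exp_add]; simp
  have hle : Real.exp (-4 * β * J) ≤ 2 / (Real.exp (4 * β * J) + 1) := by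
    rw [le_div_iff₀ (by positivity)]
    linarith
  have ht1 : ringParam N J β ≤ 1 - Real.exp (-4 * β * J) := by
    rcases ringParam_le (N := N) J β with h | h <;> linarith
  have hpos := Real.exp_pos (-4 * β * J)
  refine max_le ?_ ?_
  · have := mul_le_mul_of_nonneg_left (Real.cos_le_one (Real.pi / N)) ht
    linarith
  · have hx : |Real.pi / N| ≤ Real.pi := by
      rw [abs_of_nonneg (by positivity)]
      exact div_le_self Real.pi_pos.le hN
    have hcos := Real.cos_le_one_sub_mul_cos_sq hx
    have e : 2 / Real.pi ^ 2 * (Real.pi / N) ^ 2 = 2 * ((N : ℝ) ^ 2)⁻¹ := by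
      have := Real.pi_pos
      field_simp
    have hi : ((N : ℝ) ^ 2)⁻¹ ≤ 1 := inv_le_one_of_one_le₀ (one_le_pow₀ hN)
    have hi0 : 0 < ((N : ℝ) ^ 2)⁻¹ := by positivity
    rw [e] at hcos
    rcases le_total 0 (Real.cos (Real.pi / N)) with h0 | h0
    · have : ringParam N J β * Real.cos (Real.pi / N) ≤ 1 * Real.cos (Real.pi / N) :=
        mul_le_mul_of_nonneg_right (by linarith) h0
      linarith
    · have : ringParam N J β * Real.cos (Real.pi / N) ≤ 0 := mul_nonpos_of_nonneg_of_nonpos ht h0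
      linarith

theorem gnsInner_gibbs_self_pos (J β : ℝ) {X : QubitOp N} (hX : X ≠ 0) :
    0 < (gnsInner (gibbs (isingHamiltonian N J) β) X X).re := by
  rw [isingHamiltonian_eq_diagonal, gibbs_diagonal, gnsInner_diagonal]
  simp only [re_star_mul_self]
  obtain ⟨t, s, hts⟩ : ∃ t s, X t s ≠ 0 := by
    by_contra! h
    exact hX (Matrix.ext h)
  have hZ : 0 < ∑ u : Fin N → Fin 2, Real.exp (-β * ringEnergy J u) :=
    Finset.sum_pos (fun _ _ => Real.exp_pos _) Finset.univ_nonempty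
  refine Finset.sum_pos' (fun q _ => by positivity) ⟨(t, s), Finset.mem_univ _, ?_⟩
  have := norm_pos_iff.2 hts
  positivity

/-- The Poincaré inequality for the Davies generator: diagonal and off-diagonal entries do not
interact, the former are governed by the Glauber dynamics, the latter by dephasing. -/
theorem ising_poincare {J β : ℝ} (hJ : 0 < J) (hβ : 0 < β) (X : QubitOp N)
    (hX : (gibbs (isingHamiltonian N J) β * X).trace = 0) :
    gapBound N J β * (gnsInner (gibbs (isingHamiltonian N J) β) X X).re
      ≤ (gnsInner (gibbs (isingHamiltonian N J) β) X (-isingDavies N J β X)).re := by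
  have hσ : gibbs (isingHamiltonian N J) β = Matrix.diagonal fun s => ((Real.exp
      (-β * ringEnergy J s) * (∑ u : Fin N → Fin 2, Real.exp (-β * ringEnergy J u))⁻¹ : ℝ) : ℂ) := by
    rw [isingHamiltonian_eq_diagonal, gibbs_diagonal]
    simp only [div_eq_mul_inv]
  have hZ : 0 < ∑ u : Fin N → Fin 2, Real.exp (-β * ringEnergy J u) :=
    Finset.sum_pos (fun _ _ => Real.exp_pos _) Finset.univ_nonempty
  rw [hσ] at hX ⊢
  set K := (∑ u : Fin N → Fin 2, Real.exp (-β * ringEnergy J u))⁻¹ with hK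
  have hK0 : 0 < K := inv_pos.2 hZ
  set w : (Fin N → Fin 2) → ℝ := fun s => Real.exp (-β * ringEnergy J s) * K with hw
  have hw0 : ∀ s, 0 < w s := fun s => mul_pos (Real.exp_pos _) hK0
  have hw1 : ∀ j s, w (flipOn {j} s) * flipRate (ringParam N J β) j (flipOn {j} s)
      = w s * flipRate (ringParam N J β) j s := fun j s => by
    simp only [hw, ← glauberRate_ringEnergy]
    rw [flipOn_involutive {j} s]
    linear_combination -K * exp_mul_glauberRate_comm β (ringEnergy J s)
      (ringEnergy J (flipOn {j} s))
  have hw2 : ∀ s, w (flipOn Finset.univ s) = w s := fun s => by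
    simp only [hw, ringEnergy_flipOn_univ]
  have hoff := two_mul_sum_offDiag_le J β K hK0.le X
  have hdiag := poincare_of_forall_eigenfunction w hw0 (ringGlauber N (ringParam N J β))
    (by funext s; simp [ringGlauber_apply])
    (ringGlauber_symmetric _ w hw1 hw2) (gapBound N J β) ?_ (fun s => X s s) ?_
  · rw [gnsInner_diagonal, gnsInner_diagonal, sum_prod_eq_sum_offDiag_add_sum_diag,
      sum_prod_eq_sum_offDiag_add_sum_diag (fun q => w q.2 * _)]
    simp only [re_star_mul_self, Matrix.neg_apply, isingDavies_apply_self]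
    rw [mul_add]
    refine add_le_add (le_trans ?_ hoff) (hdiag.trans_eq ?_)
    · refine mul_le_mul_of_nonneg_right (gapBound_le_two hJ hβ) (Finset.sum_nonneg fun q _ => ?_)
      split_ifs
      exacts [le_rfl, mul_nonneg (hw0 _).le (by positivity)]
    · rw [Complex.re_sum]
      exact Finset.sum_congr rfl fun s _ => Complex.re_ofReal_mul _ _
  · intro l f hf hf0 hfl
    have ht1 : ringParam N J β ≤ 1 := by
      rcases ringParam_le (N := N) J β with h | h
      · exact h.trans (sub_le_self _ (by positivity))
      · rw [h]; exact zero_le_one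
    rcases ringGlauber_eigenvalue_bound _ (ringParam_nonneg hJ hβ) ht1 w hw0 hw1 hw2 l f hf hf0 hfl
      with h | h
    · exact (gapBound_le_two hJ hβ).trans h
    · exact (gapBound_le hJ hβ).trans h
  · rw [Matrix.trace] at hX
    simpa only [Matrix.diag_apply, Matrix.diagonal_mul] using hX

theorem isingDavies_add (J β : ℝ) (X Y : QubitOp N) :
    isingDavies N J β (X + Y) = isingDavies N J β X + isingDavies N J β Y := by
  simp only [isingDavies, davies_add, Finset.sum_add_distrib]
  abel

theorem isingDavies_smul_one (J β : ℝ) (c : ℂ) :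
    isingDavies N J β (c • 1) = 0 := by
  simp [isingDavies, davies_smul, davies_one]

theorem trace_gibbs (J β : ℝ) : (gibbs (isingHamiltonian N J) β).trace = 1 := by
  have hZ : 0 < ∑ u : Fin N → Fin 2, Real.exp (-β * ringEnergy J u) :=
    Finset.sum_pos (fun _ _ => Real.exp_pos _) Finset.univ_nonempty
  rw [isingHamiltonian_eq_diagonal, gibbs_diagonal, Matrix.trace_diagonal, ← Complex.ofReal_sum,
    ← Finset.sum_div, div_self hZ.ne', Complex.ofReal_one]

theorem isPrimitive_isingDavies {J β : ℝ} (hJ : 0 < J) (hβ : 0 < β) :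
    IsPrimitive (isingDavies N J β) := by
  intro X
  refine ⟨fun h => ?_, ?_⟩
  · set c := (gibbs (isingHamiltonian N J) β * X).trace with hc
    refine ⟨c, ?_⟩
    by_contra hne
    -- The centred part of `X` is in the kernel too, which the Poincaré inequality excludes.
    have hY : X + (-c) • (1 : QubitOp N) ≠ 0 := fun h0 => hne (by
      rw [neg_smul, ← sub_eq_add_neg] at h0
      exact sub_eq_zero.1 h0)
    have h0 : isingDavies N J β (X + (-c) • 1) = 0 := by
      rw [isingDavies_add, h, isingDavies_smul_one, add_zero]
    have htr : (gibbs (isingHamiltonian N J) β * (X + (-c) • 1)).trace = 0 := by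
      rw [mul_add, Matrix.trace_add, ← hc, Matrix.mul_smul, mul_one, Matrix.trace_smul,
        trace_gibbs, smul_eq_mul, mul_one, add_neg_cancel]
    have hp := ising_poincare hJ hβ _ htr
    have hpos := mul_pos (gapBound_pos (N := N) J β) (gnsInner_gibbs_self_pos J β hY)
    rw [h0] at hp
    simp only [gnsInner, neg_zero, mul_zero, zero_mul, Matrix.trace_zero, Complex.zero_re] at hp
    exact absurd hpos (not_lt.2 hp)
  · rintro ⟨c, rfl⟩
    exact isingDavies_smul_one J β c

theorem gapBound_le_spectralGap {J β : ℝ} (hJ : 0 < J) (hβ : 0 < β) :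
    gapBound N J β
      ≤ spectralGap (gibbs (isingHamiltonian N J) β) (isingDavies N J β) := by
  refine le_csInf ?_ ?_
  · -- `σˣ` at one site is a centred observable, so that the infimum is over a nonempty set.
    refine ⟨_, onSite 0 pauliX, fun h => ?_, ?_, rfl⟩
    · have := congrFun (congrFun h (flipOn {0} 0)) 0
      simp [onSite_pauliX] at this
    · rw [isingHamiltonian_eq_diagonal, gibbs_diagonal, Matrix.trace]
      refine Finset.sum_eq_zero fun s _ => ?_
      have hne : s ≠ flipOn {0} s := fun h => by
        have := congrFun h 0
        simp [flipOn] at this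
      rw [Matrix.diag_apply, Matrix.diagonal_mul, onSite_pauliX, Matrix.of_apply, if_neg hne,
        mul_zero]
  · rintro _ ⟨X, hX, htr, rfl⟩
    rw [le_div_iff₀ (gnsInner_gibbs_self_pos J β hX)]
    exact ising_poincare hJ hβ X htr

end Gap

end DaviesIsing

end

theorem mainTheorem4 :
    ∃ c₁ : ℝ, 0 < c₁ ∧ ∃ c₂ : ℝ, 0 < c₂ ∧
      ∀ (N : ℕ) [NeZero N] (J β : ℝ), 0 < J → 0 < β →
        DaviesIsing.IsPrimitive (DaviesIsing.isingDavies N J β) ∧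
        max (c₁ * Real.exp (-4 * β * J)) (c₂ * ((N : ℝ) ^ 2)⁻¹) ≤
          DaviesIsing.spectralGap
            (DaviesIsing.gibbs (DaviesIsing.isingHamiltonian N J) β)
            (DaviesIsing.isingDavies N J β) :=
  ⟨2, two_pos, 2, two_pos, fun _ _ _ _ hJ hβ =>
    ⟨DaviesIsing.isPrimitive_isingDavies hJ hβ, DaviesIsing.gapBound_le_spectralGap hJ hβ⟩⟩
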